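/- Theorem 6.3 (Convergence rate of stochastic STM). Let $Q\subseteq\mathbb R^n$ be closed and convex, let $f$ be differentiable on $Q$ with $\|\nabla f(x)-\nabla f(y)\|_2\le L_f\|x-y\|_2$ ($L_f>0$) and $f(x)+\langle\nabla f(x),y-x\rangle+\frac{\mu}{2}\|x-y\|_2^2\le f(y)$ ($\mu\ge 0$) for all $x,y\in Q$. Let $x^*\in Q$ be a minimizer of $f$ on $Q$, let $x_{start}\in Q$ and $\|x_{start}-x^*\|_2\le R$. Put $L=2L_f$. Let $\xi_0,\xi_1,\dots$ be random elements adapted to a filtration $(\mathcal F_k)$ in the sense that $\xi_k$ is $\mathcal F_{k+1}$-measurable, and let $\tilde\nabla f(x,\xi)$ be a jointly measurable stochastic gradient such that, for some $\delta\ge 0$, for every $k$ and every (possibly random) $\mathcal F_k$-measurable point $x$ with values in $Q$, $$\mathbb E\big[\|\tilde\nabla f(x,\xi_k)-\nabla f(x)\|_2^2\,\big|\,\mathcal F_k\big]\le\delta^2\quad\text{a.s.}$$ (for example, $\xi_k$ independent of $\mathcal F_k$ and $\mathbb E\|\tilde\nabla f(x,\xi_k)-\nabla f(x)\|_2^2\le\delta^2$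 for each fixed $x\in Q$). Unbiasedness is not required. For $m\ge 0$, Algorithm $\mathrm{STM}(L,m,x_{start})$ generates random sequences $\tilde x_k,z_k,x_k$ as follows. Set $\tilde x_0=x_{start}$, $\alpha_0=A_0=\frac1L$, $$\psi_0(y)=\tfrac12\|y-\tilde x_0\|_2^2+\alpha_0\big(f(\tilde x_0)+\langle\tilde\nabla f(\tilde x_0,\xi_0),y-\tilde x_0\rangle+\tfrac m2\|y-\tilde x_0\|_2^2\big),\qquad z_0=x_0=\operatorname*{argmin}_{y\in Q}\psi_0(y).$$ For $k\ge 1$ let $\alpha_k$ be the larger root of $(1+mA_{k-1})(A_{k-1}+\alpha_k)=L\alpha_k^2$, $A_k=A_{k-1}+\alpha_k$, and $$\tilde x_k=\frac{A_{k-1}x_{k-1}+\alpha_kz_{k-1}}{A_k},\qquad \psi_k(y)=\psi_{k-1}(y)+\alpha_k\big(f(\tilde x_k)+\langle\tilde\nabla f(\tilde x_k,\xi_k),y-\tilde x_k\rangle+\tfrac m2\|y-\tilde x_k\|_2^2\big),$$ $$z_k=\operatorname*{argmin}_{y\in Q}\psi_k(y),\qquad x_k=\frac{A_{k-1}x_{k-1}+\alpha_kz_k}{A_k}.$$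 Put $\mu_1=\mu$, $\mu_2=\frac\mu2$, $\delta_1=\delta$, $\delta_2=\frac{\delta^2}{L}$, $\delta_3=\frac{\delta^2}{\mu}$ (if $\mu\ne0$) and $\tilde B_N=\max_{0\le j\le N}\{\mathbb E\|z_j-x^*\|_2,\ \mathbb E\|x_j-x^*\|_2,\ \mathbb E\|\tilde x_j-x^*\|_2\}$. Then, in each case below, all of the expectations involved exist and are finite, and the following hold. If $\mu\ne0$, the sequences generated with $m=\mu_1$ satisfy, for all $N\ge0$, $$\mathbb Ef(x_N)-f(x^*)\le LR^2\exp\Big(-\tfrac12\sqrt{\tfrac{\mu_1}{L}}\,N\Big)+\Big(1+\sqrt{\tfrac{L}{\mu_1}}\Big)\delta_2+3\tilde B_N\delta_1,$$ and the sequences generated with $m=\mu_2$ satisfy, for all $N\ge0$, $$\mathbb Ef(x_N)-f(x^*)\le LR^2\exp\Big(-\tfrac12\sqrt{\tfrac{\mu_2}{L}}\,N\Big)+\Big(1+\sqrt{\tfrac{L}{\mu_2}}\Big)\delta_2+\Big(1+\sqrt{\tfrac{L}{\mu_2}}\Big)\delta_3.$$ If $\mu=0$, the sequences generated with $m=0$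 satisfy, for all $N\ge1$, $$\mathbb Ef(x_N)-f(x^*)\le\frac{4LR^2}{N^2}+3\tilde B_N\delta_1+N\delta_2.$$ -/

import Mathlib

open MeasureTheory ProbabilityTheory
open scoped RealInnerProductSpace

noncomputable section

namespace STM

/-- `f` is differentiable on `Q` with gradient `f'`, and the gradient is `L`-Lipschitz on `Q`. -/
def SmoothOn {n : ℕ} (Q : Set (EuclideanSpace ℝ (Fin n))) (f : EuclideanSpace ℝ (Fin n) → ℝ)
    (f' : EuclideanSpace ℝ (Fin n) → EuclideanSpace ℝ (Fin n)) (L : ℝ) : Prop :=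
  (∀ x ∈ Q, HasGradientWithinAt f (f' x) Q x) ∧
    ∀ x ∈ Q, ∀ y ∈ Q, ‖f' x - f' y‖ ≤ L * ‖x - y‖

/-- Strong convexity with parameter `μ` on `Q`, for `f` with gradient `f'`
(`μ = 0` is plain convexity). -/
def StrongConvexGrad {n : ℕ} (Q : Set (EuclideanSpace ℝ (Fin n)))
    (f : EuclideanSpace ℝ (Fin n) → ℝ)
    (f' : EuclideanSpace ℝ (Fin n) → EuclideanSpace ℝ (Fin n)) (μ : ℝ) : Prop :=
  ∀ x ∈ Q, ∀ y ∈ Q, f x + ⟪f' x, y - x⟫ + μ / 2 * ‖x - y‖ ^ 2 ≤ f y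

/-- The larger root `a` of `(1 + m * A) * (A + a) = L * a ^ 2`. -/
def stepRoot (L m A : ℝ) : ℝ :=
  (1 + m * A) / (2 * L) +
    Real.sqrt ((1 + m * A) ^ 2 / (4 * L ^ 2) + A * (1 + m * A) / L)

/-- The sequence `A_k`: `A_0 = 1 / L`, `A_{k+1} = A_k + α_{k+1}`. -/
def seqA (L m : ℝ) : ℕ → ℝ
  | 0 => 1 / L
  | k + 1 => seqA L m k + stepRoot L m (seqA L m k)

/-- The sequence `α_k`: `α_0 = 1 / L`, and `α_{k+1}` solves
`(1 + m * A_k) * (A_k + α_{k+1}) = L * α_{k+1} ^ 2`. -/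
def seqα (L m : ℝ) : ℕ → ℝ
  | 0 => 1 / L
  | k + 1 => stepRoot L m (seqA L m k)

/-- The linear-quadratic model of `f` at `u` with inexact gradient `g` and modulus `m`. -/
def model {n : ℕ} (f : EuclideanSpace ℝ (Fin n) → ℝ) (m : ℝ)
    (u g y : EuclideanSpace ℝ (Fin n)) : ℝ :=
  f u + ⟪g, y - u⟫ + m / 2 * ‖y - u‖ ^ 2

/-- The functions `ψ_k`, built from the query points `xt j` and the inexact gradients `g j`
returned there. -/
def psi {n : ℕ} (f : EuclideanSpace ℝ (Fin n) → ℝ) (L m : ℝ)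
    (xt g : ℕ → EuclideanSpace ℝ (Fin n)) : ℕ → EuclideanSpace ℝ (Fin n) → ℝ
  | 0, y => 1 / 2 * ‖y - xt 0‖ ^ 2 + seqα L m 0 * model f m (xt 0) (g 0) y
  | k + 1, y => psi f L m xt g k y + seqα L m (k + 1) * model f m (xt (k + 1)) (g (k + 1)) y

/-- `xt`, `z`, `x` are the sequences `x̃_k`, `z_k`, `x_k` which the Similar Triangles Method
with parameters `L`, `m` and starting point `x₀` generates on the feasible set `Q`, when `g k`
is the inexact gradient which it is given at the query point `xt k`. -/
structure IsRun {n : ℕ} (Q : Set (EuclideanSpace ℝ (Fin n))) (f : EuclideanSpace ℝ (Fin n) → ℝ)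
    (L m : ℝ) (x₀ : EuclideanSpace ℝ (Fin n)) (g xt z x : ℕ → EuclideanSpace ℝ (Fin n)) :
    Prop where
  xt_zero : xt 0 = x₀
  z_mem : ∀ k, z k ∈ Q
  z_argmin : ∀ k, IsMinOn (psi f L m xt g k) Q (z k)
  x_zero : x 0 = z 0
  xt_succ : ∀ k, xt (k + 1) =
    (seqA L m (k + 1))⁻¹ • (seqA L m k • x k + seqα L m (k + 1) • z k)
  x_succ : ∀ k, x (k + 1) =
    (seqA L m (k + 1))⁻¹ • (seqA L m k • x k + seqα L m (k + 1) • z (k + 1))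

/-- The random sequences `xt`, `z`, `x` are generated by the Similar Triangles Method, with the
stochastic gradient `G (xt k) (ξ k)` used at step `k`. -/
def IsStochasticRun {n : ℕ} {Ω Ξ : Type*} (Q : Set (EuclideanSpace ℝ (Fin n)))
    (f : EuclideanSpace ℝ (Fin n) → ℝ)
    (G : EuclideanSpace ℝ (Fin n) → Ξ → EuclideanSpace ℝ (Fin n)) (ξ : ℕ → Ω → Ξ)
    (L m : ℝ) (x₀ : EuclideanSpace ℝ (Fin n))
    (xt z x : ℕ → Ω → EuclideanSpace ℝ (Fin n)) : Prop :=
  ∀ ω, IsRun Q f L m x₀ (fun k => G (xt k ω) (ξ k ω)) (fun k => xt k ω) (fun k => z k ω)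
    (fun k => x k ω)

/-- The stochastic gradient has conditional second-moment error at most `δ ^ 2`:
`E[‖G(X, ξ_k) - ∇f(X)‖² | ℱ_k] ≤ δ²` almost surely, for every step `k` and every, possibly random,
point `X` of `Q` that is determined by the information `ℱ_k` available before `ξ_k` is drawn.
It holds, for instance, if `ξ_k` is independent of `ℱ_k` and
`E ‖G(x, ξ_k) - ∇f(x)‖² ≤ δ²` for every fixed `x` in `Q`. No unbiasedness is required. -/
def BoundedNoise {n : ℕ} {Ω Ξ : Type*} [mΩ : MeasurableSpace Ω] (P : Measure Ω)
    (ℱ : Filtration ℕ mΩ) (Q : Set (EuclideanSpace ℝ (Fin n)))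
    (f' : EuclideanSpace ℝ (Fin n) → EuclideanSpace ℝ (Fin n))
    (G : EuclideanSpace ℝ (Fin n) → Ξ → EuclideanSpace ℝ (Fin n)) (ξ : ℕ → Ω → Ξ) (δ : ℝ) :
    Prop :=
  ∀ (k : ℕ) (X : Ω → EuclideanSpace ℝ (Fin n)), Measurable[ℱ k] X → (∀ ω, X ω ∈ Q) →
    Integrable (fun ω => ‖G (X ω) (ξ k ω) - f' (X ω)‖ ^ 2) P ∧
    P[fun ω => ‖G (X ω) (ξ k ω) - f' (X ω)‖ ^ 2 | ℱ k] ≤ᵐ[P] fun _ => δ ^ 2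

/-- `B̃_k`: the largest of the expected distances of `z_j`, `x_j`, `x̃_j`, `0 ≤ j ≤ k`,
to `xs`. -/
def maxExpDist {n : ℕ} {Ω : Type*} [MeasurableSpace Ω] (P : Measure Ω)
    (xs : EuclideanSpace ℝ (Fin n)) (xt z x : ℕ → Ω → EuclideanSpace ℝ (Fin n)) (k : ℕ) : ℝ :=
  (Finset.range (k + 1)).sup' Finset.nonempty_range_add_one fun j =>
    max (∫ ω, ‖z j ω - xs‖ ∂P) (max (∫ ω, ‖x j ω - xs‖ ∂P) (∫ ω, ‖xt j ω - xs‖ ∂P))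

/-- All expectations in the convergence bound exist: `f(x_k)` and the distances of the iterates
to `xs` are integrable. -/
def HasExpectations {n : ℕ} {Ω : Type*} [MeasurableSpace Ω] (P : Measure Ω)
    (f : EuclideanSpace ℝ (Fin n) → ℝ) (xs : EuclideanSpace ℝ (Fin n))
    (xt z x : ℕ → Ω → EuclideanSpace ℝ (Fin n)) : Prop :=
  ∀ k, Integrable (fun ω => f (x k ω)) P ∧ Integrable (fun ω => ‖z k ω - xs‖) P ∧
    Integrable (fun ω => ‖x k ω - xs‖) P ∧ Integrable (fun ω => ‖xt k ω - xs‖) P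

end STM

end

/-! The proof is an estimate-sequence argument that tracks the noise e_j = g_j - ∇f(x̃_j)
explicitly. It propagates A_k f(x_k) ≤ ψ_k(z_k) + errors (`IsRun.step_succ`). By the equation for
α_k, the curvature of ψ_{k-1} supplies A_k (L/2)‖x_k - x̃_k‖², while smoothness with L = 2L_f costs
only half of this. The spare half absorbs e_k by Young's inequality at the price A_k‖e_k‖²/L.
Comparing ψ_N(z_N) with ψ_N(x*) then bounds A_N (f(x_N) - f(x*)).

With m = μ, the linear lower bounds at x_{k-1} and at x* leave the term α_k⟨e_k, x* - z_{k-1}⟩.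
Since z_{k-1} is known before ξ_k is drawn, conditional Cauchy-Schwarz bounds its mean by α_k δ
E‖z_{k-1} - x*‖, without unbiasedness. The α_k sum to A_N, so these terms cost at most B̃_N δ after
division by A_N. With m = μ/2, the unused half of the strong convexity absorbs the noise in the
lower bounds at the price ‖e_k‖²/μ, and only second moments enter.

The rates then follow from the growth of A_N, geometric for m > 0 and quadratic for m = 0, and from
bounds on the sums of the A_j relative to A_N. Geometric growth uses m ≤ L, which strong convexity
and smoothness imply once Q has two points. -/

namespace STM

/-! ### Growth of the step-size sequences. -/

section Sequences

variable {L m : ℝ}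

lemma stepRoot_eq (hL : 0 < L) (hm : 0 ≤ m) {A : ℝ} (hA : 0 ≤ A) :
    (1 + m * A) * (A + stepRoot L m A) = L * stepRoot L m A ^ 2 := by
  have hs := Real.sq_sqrt (show 0 ≤ (1 + m * A) ^ 2 / (4 * L ^ 2) + A * (1 + m * A) / L by
    positivity)
  unfold stepRoot
  set s := Real.sqrt ((1 + m * A) ^ 2 / (4 * L ^ 2) + A * (1 + m * A) / L)
  have h : L * ((1 + m * A) / (2 * L) + s) ^ 2
      = (1 + m * A) ^ 2 / (4 * L) + (1 + m * A) * s + L * s ^ 2 := by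
    field_simp; ring
  rw [h, hs]
  field_simp; ring

lemma stepRoot_pos (hL : 0 < L) (hm : 0 ≤ m) {A : ℝ} (hA : 0 ≤ A) : 0 < stepRoot L m A := by
  unfold stepRoot
  have : 0 ≤ m * A := mul_nonneg hm hA
  positivity

lemma seqA_pos (hL : 0 < L) (hm : 0 ≤ m) : ∀ k, 0 < seqA L m k
  | 0 => by simp only [seqA]; positivity
  | k + 1 => by
    have h := seqA_pos hL hm k
    have := stepRoot_pos hL hm h.le
    simp only [seqA]; positivity

lemma seqα_pos (hL : 0 < L) (hm : 0 ≤ m) : ∀ k, 0 < seqα L m k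
  | 0 => by simp only [seqα]; positivity
  | k + 1 => stepRoot_pos hL hm (seqA_pos hL hm k).le

lemma seqA_succ (k : ℕ) : seqA L m (k + 1) = seqA L m k + seqα L m (k + 1) := rfl

lemma seqA_le_succ (hL : 0 < L) (hm : 0 ≤ m) (k : ℕ) : seqA L m k ≤ seqA L m (k + 1) := by
  have := seqα_pos hL hm (k + 1)
  rw [seqA_succ]; linarith

lemma sum_seqα (N : ℕ) : ∑ j ∈ Finset.range (N + 1), seqα L m j = seqA L m N := by
  induction N with
  | zero => simp [seqα, seqA]
  | succ N ih => rw [Finset.sum_range_succ, ih, seqA_succ]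

lemma seqα_sq_succ (hL : 0 < L) (hm : 0 ≤ m) (k : ℕ) :
    (1 + m * seqA L m k) * seqA L m (k + 1) = L * seqα L m (k + 1) ^ 2 :=
  stepRoot_eq hL hm (seqA_pos hL hm k).le

/-- The recursion has A_{k-1} in the first factor; this weaker form also covers k = 0. It lets the
curvature 1 + mA_N of ψ_N absorb the last noise term. -/
lemma seqα_sq_le (hL : 0 < L) (hm : 0 ≤ m) (k : ℕ) :
    L * seqα L m k ^ 2 ≤ (1 + m * seqA L m k) * seqA L m k := by
  cases k with
  | zero =>
    simp only [seqα, seqA]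
    have : (1 + m * (1 / L)) * (1 / L) = L * (1 / L) ^ 2 + m * (1 / L) ^ 2 := by
      field_simp
    rw [this]
    have : 0 ≤ m * (1 / L) ^ 2 := by positivity
    linarith
  | succ k =>
    rw [← seqα_sq_succ hL hm]
    have := seqA_pos hL hm (k + 1)
    have := seqA_le_succ hL hm k
    gcongr

lemma seqA_growth (hL : 0 < L) (hm : 0 ≤ m) (hmL : m ≤ L) (k : ℕ) :
    (1 + Real.sqrt (m / L) / 2) ^ 2 * seqA L m k ≤ seqA L m (k + 1) := by
  set q := Real.sqrt (m / L) with hq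
  have hq0 : 0 ≤ q := Real.sqrt_nonneg _
  have hq2 : q ^ 2 = m / L := Real.sq_sqrt (by positivity)
  have hq1 : q ≤ 1 := by
    rw [hq, Real.sqrt_le_one]
    exact (div_le_one hL).2 hmL
  have hA := seqA_pos hL hm k
  have ha := seqα_pos hL hm (k + 1)
  have h := seqα_sq_succ hL hm k
  rw [seqA_succ] at h ⊢
  set A := seqA L m k
  set a := seqα L m (k + 1)
  have hmq : m = q ^ 2 * L := by rw [hq2]; field_simp
  have h1 : q ^ 2 * A * (A + a) ≤ a ^ 2 := by
    have : L * (q ^ 2 * A * (A + a)) ≤ L * a ^ 2 := by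
      rw [← h, hmq]; nlinarith
    exact le_of_mul_le_mul_left this hL
  -- Otherwise a < (q + q²/4)A. Inserted twice into q²A(A + a) ≤ a², this is contradictory for q >
  -- 0; for q = 0 it says a < 0.
  by_contra! hlt
  have h2 : a < (q + q ^ 2 / 4) * A := by nlinarith
  have h3 : a ^ 2 ≤ a * ((q + q ^ 2 / 4) * A) := by nlinarith
  have h4 : 0 ≤ q + q ^ 2 / 4 - q ^ 2 := by nlinarith
  have h5 : a * A * (q + q ^ 2 / 4 - q ^ 2) ≤
      (q + q ^ 2 / 4) * A * A * (q + q ^ 2 / 4 - q ^ 2) := by gcongr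
  have h6 : (q + q ^ 2 / 4) * A * A * (q + q ^ 2 / 4 - q ^ 2) - q ^ 2 * A * A
      = - (q ^ 3 * A ^ 2 * (1 / 2 + 3 / 16 * q)) := by ring
  rcases hq0.eq_or_lt with h0 | h0
  · rw [← h0] at h2; norm_num at h2; linarith
  · have : 0 < q ^ 3 * A ^ 2 * (1 / 2 + 3 / 16 * q) := by positivity
    nlinarith

lemma exp_le_seqA (hL : 0 < L) (hm : 0 ≤ m) (hmL : m ≤ L) (N : ℕ) :
    1 / L * Real.exp (1 / 2 * Real.sqrt (m / L) * N) ≤ seqA L m N := by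
  induction N with
  | zero => simp [seqA]
  | succ N ih =>
    refine le_trans ?_ (seqA_growth hL hm hmL N)
    have hq1 : Real.sqrt (m / L) ≤ 1 := by
      rw [Real.sqrt_le_one]
      exact (div_le_one hL).2 hmL
    have hq0 : 0 ≤ Real.sqrt (m / L) := Real.sqrt_nonneg _
    set q := Real.sqrt (m / L)
    -- For q ≤ 1, exp(q/4) ≤ 1/(1 - q/4) ≤ 1 + q/2; then square.
    have he : Real.exp (1 / 2 * q) ≤ (1 + q / 2) ^ 2 := by
      have h1 : Real.exp (q / 4) ≤ 1 + q / 2 := by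
        have h2 : 1 - q / 4 ≤ Real.exp (-(q / 4)) := by
          have := Real.add_one_le_exp (-(q / 4)); linarith
        have h3 : Real.exp (q / 4) * Real.exp (-(q / 4)) = 1 := by
          rw [← Real.exp_add]; simp
        have h4 := Real.exp_pos (q / 4)
        have h5 : Real.exp (q / 4) * (1 - q / 4) ≤ 1 :=
          (mul_le_mul_of_nonneg_left h2 h4.le).trans_eq h3
        have h6 : 1 ≤ (1 + q / 2) * (1 - q / 4) := by nlinarith
        have h7 : 0 < 1 - q / 4 := by linarith
        exact le_of_mul_le_mul_right (h5.trans h6) h7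
      calc Real.exp (1 / 2 * q) = Real.exp (q / 4) ^ 2 := by
            rw [← Real.exp_nat_mul]; congr 1; push_cast; ring
        _ ≤ _ := by gcongr
    calc 1 / L * Real.exp (1 / 2 * q * ((N + 1 : ℕ) : ℝ))
        = Real.exp (1 / 2 * q) * (1 / L * Real.exp (1 / 2 * q * N)) := by
          push_cast
          rw [mul_add, Real.exp_add]; ring_nf
      _ ≤ _ := by gcongr

/-- Each step multiplies A by at least 1 + q with q = √(m/L), so the sum is dominated by a geometric
series with total 1 + 1/q. -/
lemma sum_seqA_le (hL : 0 < L) (hm : 0 < m) (hmL : m ≤ L) (N : ℕ) :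
    ∑ j ∈ Finset.range (N + 1), seqA L m j ≤ (1 + Real.sqrt (L / m)) * seqA L m N := by
  have hq : 0 < Real.sqrt (m / L) := Real.sqrt_pos.2 (by positivity)
  have hinv : Real.sqrt (L / m) = (Real.sqrt (m / L))⁻¹ := by
    rw [← Real.sqrt_inv, inv_div]
  rw [hinv]
  induction N with
  | zero =>
    have := seqA_pos hL hm.le 0
    rw [zero_add, Finset.sum_range_one]
    have : 0 ≤ (Real.sqrt (m / L))⁻¹ * seqA L m 0 := by positivity
    linarith
  | succ N ih =>
    rw [Finset.sum_range_succ]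
    have hg := seqA_growth hL hm.le hmL N
    have hA := seqA_pos hL hm.le N
    set q := Real.sqrt (m / L)
    have h1 : (1 + q) * seqA L m N ≤ seqA L m (N + 1) := by nlinarith [sq_nonneg q]
    have h2 : (1 + q⁻¹) * seqA L m N ≤ q⁻¹ * seqA L m (N + 1) := by
      calc (1 + q⁻¹) * seqA L m N = q⁻¹ * ((1 + q) * seqA L m N) := by field_simp; ring
        _ ≤ _ := by gcongr
    linarith

/-- With m = 0 the recursion reads A + a = La², so 4LA = (2La - 1)² - 1 while 4L(A + a) = (2La)²:
the square root of 4LA_k grows by at least one per step. -/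
lemma sq_le_seqA_zero (hL : 0 < L) (N : ℕ) :
    ((N : ℝ) + 2) ^ 2 / (4 * L) ≤ seqA L 0 N := by
  induction N with
  | zero => simp only [seqA]; apply le_of_eq; push_cast; field_simp; norm_num
  | succ N ih =>
    have h := seqα_sq_succ hL le_rfl N
    have ha := seqα_pos hL (le_refl (0 : ℝ)) (N + 1)
    rw [zero_mul, add_zero, one_mul] at h
    have h' := h
    rw [seqA_succ] at h
    rw [h']
    rw [div_le_iff₀ (by positivity)] at ih ⊢
    set a := seqα L 0 (N + 1)
    have h1 : ((N : ℝ) + 2) ^ 2 ≤ (2 * L * a - 1) ^ 2 := by nlinarith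
    have h2 : (N : ℝ) + 2 ≤ 2 * L * a - 1 := by
      rcases le_or_gt 0 (2 * L * a - 1) with h3 | h3
      · exact (abs_le_of_sq_le_sq' h1 h3).2
      · exfalso
        have : 0 < 2 * L * a := by positivity
        have : (2 * L * a - 1) ^ 2 < 1 := by nlinarith
        have : (0 : ℝ) ≤ N := N.cast_nonneg
        nlinarith
    have : (0 : ℝ) ≤ N := N.cast_nonneg
    push_cast
    calc ((N : ℝ) + 1 + 2) ^ 2 ≤ (2 * L * a) ^ 2 := by
          apply pow_le_pow_left₀ (by positivity); linarith
      _ = _ := by ring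

/-- Halving the last weight is what allows the coefficient N. The case N = 1 needs A_1 ≥ 2A_0, which
follows from A_1 ≥ 9/(4L); afterwards monotonicity suffices. -/
lemma sum_seqA_zero_le (hL : 0 < L) {N : ℕ} (hN : 1 ≤ N) :
    ∑ j ∈ Finset.range N, seqA L 0 j + seqA L 0 N / 2 ≤ N * seqA L 0 N := by
  induction N, hN using Nat.le_induction with
  | base =>
    have h := sq_le_seqA_zero hL 1
    rw [Finset.sum_range_one]
    have h0 : seqA L 0 0 = 1 / L := rfl
    have h1 : (((1 : ℕ) : ℝ) + 2) ^ 2 / (4 * L) = 9 / 4 * (1 / L) := by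
      push_cast; field_simp; norm_num
    have : 0 < 1 / L := by positivity
    rw [h1] at h
    rw [h0]; push_cast
    linarith
  | succ N _ ih =>
    rw [Finset.sum_range_succ]
    have h := seqA_le_succ hL (le_refl (0 : ℝ)) N
    have : (0 : ℝ) ≤ N := N.cast_nonneg
    push_cast
    nlinarith

end Sequences

/-! ### Smoothness, strong convexity and constrained minimizers of quadratics. -/

section Convex

variable {n : ℕ} {Q : Set (EuclideanSpace ℝ (Fin n))} {f : EuclideanSpace ℝ (Fin n) → ℝ}
  {f' : EuclideanSpace ℝ (Fin n) → EuclideanSpace ℝ (Fin n)}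

/-- The gradient exists only within Q, so the argument stays on the segment from u to y: f minus the
quadratic has nonpositive derivative along it. -/
lemma SmoothOn.le_quadratic {K : ℝ} (h : SmoothOn Q f f' K) (hQ : Convex ℝ Q)
    {u y : EuclideanSpace ℝ (Fin n)} (hu : u ∈ Q) (hy : y ∈ Q) :
    f y ≤ f u + ⟪f' u, y - u⟫ + K / 2 * ‖y - u‖ ^ 2 := by
  have hmem : ∀ t ∈ Set.Icc (0 : ℝ) 1, u + t • (y - u) ∈ Q := fun t ht =>
    hQ.add_smul_sub_mem hu hy ht
  have hd : ∀ t ∈ Set.Icc (0 : ℝ) 1, HasDerivWithinAt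
      (fun t : ℝ => f (u + t • (y - u)) - (t * ⟪f' u, y - u⟫ + K / 2 * ‖y - u‖ ^ 2 * t ^ 2))
      (⟪f' (u + t • (y - u)), y - u⟫ - (⟪f' u, y - u⟫ + K * ‖y - u‖ ^ 2 * t))
      (Set.Icc 0 1) t := by
    intro t ht
    have h1 : HasDerivWithinAt (fun t : ℝ => u + t • (y - u)) (y - u) (Set.Icc 0 1) t := by
      simpa using (((hasDerivAt_id t).smul_const (y - u)).const_add u).hasDerivWithinAt
    have h2 := (h.1 _ (hmem t ht)).hasFDerivWithinAt.comp_hasDerivWithinAt t h1 hmem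
    have h3 : HasDerivAt (fun t : ℝ => t * ⟪f' u, y - u⟫ + K / 2 * ‖y - u‖ ^ 2 * t ^ 2)
        (⟪f' u, y - u⟫ + K * ‖y - u‖ ^ 2 * t) t := by
      refine (((hasDerivAt_id t).mul_const _).add
        (((hasDerivAt_id t).pow 2).const_mul (K / 2 * ‖y - u‖ ^ 2))).congr_deriv ?_
      simp; ring
    refine (h2.sub h3.hasDerivWithinAt).congr_deriv ?_
    simp
  have hanti := antitoneOn_of_deriv_nonpos (convex_Icc (0 : ℝ) 1)
    (fun t ht => (hd t ht).continuousWithinAt)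
    (fun t ht => ((hd t (interior_subset ht)).mono interior_subset).differentiableWithinAt)
    (fun t ht => by
      rw [((hd t (interior_subset ht)).hasDerivAt (mem_interior_iff_mem_nhds.1 ht)).deriv]
      have ht' := interior_subset ht
      have h1 : ⟪f' (u + t • (y - u)) - f' u, y - u⟫ ≤ K * ‖t • (y - u)‖ * ‖y - u‖ := by
        refine (real_inner_le_norm _ _).trans ?_
        gcongr
        simpa using h.2 _ (hmem t ht') _ hu
      rw [inner_sub_left, norm_smul, Real.norm_of_nonneg ht'.1] at h1
      nlinarith)
  have := hanti (Set.left_mem_Icc.2 zero_le_one) (Set.right_mem_Icc.2 zero_le_one) zero_le_one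
  simp at this
  linarith

lemma SmoothOn.continuousOn {K : ℝ} (h : SmoothOn Q f f' K) : ContinuousOn f Q :=
  fun x hx => (h.1 x hx).hasFDerivWithinAt.continuousWithinAt

lemma SmoothOn.continuousOn_gradient {K : ℝ} (hK : 0 ≤ K) (h : SmoothOn Q f f' K) :
    ContinuousOn f' Q := by
  have : LipschitzOnWith K.toNNReal f' Q := LipschitzOnWith.of_dist_le_mul fun x hx y hy => by
    rw [Real.coe_toNNReal K hK, dist_eq_norm, dist_eq_norm]
    exact h.2 x hx y hy
  exact this.continuousOn

lemma le_of_strongConvexGrad_of_smoothOn {K μ : ℝ} (h : SmoothOn Q f f' K)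
    (hc : StrongConvexGrad Q f f' μ) (hQ : Q.Nontrivial) : μ ≤ K := by
  obtain ⟨x, hx, y, hy, hxy⟩ := hQ
  have hpos : 0 < ‖x - y‖ := norm_pos_iff.2 (sub_ne_zero.2 hxy)
  have h1 := hc x hx y hy
  have h2 := hc y hy x hx
  have h3 : ⟪f' x - f' y, x - y⟫ ≤ K * ‖x - y‖ * ‖x - y‖ :=
    (real_inner_le_norm _ _).trans (by gcongr; exact h.2 x hx y hy)
  rw [← neg_sub x y, inner_neg_right] at h1
  rw [norm_sub_rev y x] at h2
  rw [inner_sub_left] at h3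
  have : μ * ‖x - y‖ ^ 2 ≤ K * ‖x - y‖ ^ 2 := by linarith
  exact le_of_mul_le_mul_right this (by positivity)

lemma inner_le_zero_of_isMinOn_quadratic (hQ : Convex ℝ Q) {κ b : ℝ}
    {c z : EuclideanSpace ℝ (Fin n)}
    (hz : z ∈ Q) (hmin : IsMinOn (fun y => κ / 2 * ‖y‖ ^ 2 - ⟪c, y⟫ + b) Q z)
    {y : EuclideanSpace ℝ (Fin n)} (hy : y ∈ Q) : ⟪c - κ • z, y - z⟫ ≤ 0 := by
  -- Compare z with z + t(y - z), divide by t, and let t tend to 0.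
  have key : ∀ t ∈ Set.Ioc (0 : ℝ) 1, ⟪c - κ • z, y - z⟫ ≤ κ / 2 * ‖y - z‖ ^ 2 * t := by
    intro t ht
    have h := isMinOn_iff.1 hmin _ (hQ.add_smul_sub_mem hz hy ⟨ht.1.le, ht.2⟩)
    rw [norm_add_sq_real, inner_smul_right, inner_add_right, inner_smul_right, norm_smul,
      Real.norm_of_nonneg ht.1.le] at h
    rw [inner_sub_left, real_inner_smul_left]
    have : t * (⟪c, y - z⟫ - κ * ⟪z, y - z⟫) ≤ t * (κ / 2 * ‖y - z‖ ^ 2 * t) := by linarith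
    exact le_of_mul_le_mul_left this ht.1
  have hlim : Filter.Tendsto (fun t : ℝ => κ / 2 * ‖y - z‖ ^ 2 * t)
      (nhdsWithin 0 (Set.Ioi 0)) (nhds 0) := by
    have : Continuous fun t : ℝ => κ / 2 * ‖y - z‖ ^ 2 * t := by fun_prop
    simpa using (this.tendsto 0).mono_left nhdsWithin_le_nhds
  refine ge_of_tendsto hlim ?_
  filter_upwards [Ioc_mem_nhdsGT (zero_lt_one' ℝ)] with t ht using key t ht

lemma quadratic_growth_of_isMinOn (hQ : Convex ℝ Q) {κ b : ℝ}
    {c z : EuclideanSpace ℝ (Fin n)}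
    (hz : z ∈ Q) (hmin : IsMinOn (fun y => κ / 2 * ‖y‖ ^ 2 - ⟪c, y⟫ + b) Q z)
    {y : EuclideanSpace ℝ (Fin n)} (hy : y ∈ Q) :
    κ / 2 * ‖z‖ ^ 2 - ⟪c, z⟫ + b + κ / 2 * ‖y - z‖ ^ 2 ≤ κ / 2 * ‖y‖ ^ 2 - ⟪c, y⟫ + b := by
  have h := inner_le_zero_of_isMinOn_quadratic hQ hz hmin hy
  have hyz : y = z + (y - z) := by abel
  rw [inner_sub_left, real_inner_smul_left] at h
  have h1 : ‖y‖ ^ 2 = ‖z‖ ^ 2 + 2 * ⟪z, y - z⟫ + ‖y - z‖ ^ 2 := by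
    conv_lhs => rw [hyz, norm_add_sq_real]
  have h2 : ⟪c, y⟫ = ⟪c, z⟫ + ⟪c, y - z⟫ := by
    conv_lhs => rw [hyz, inner_add_right]
  rw [h1, h2]
  linarith

/-- Adding the two variational inequalities gives nonexpansiveness of the projection; p = q gives
its uniqueness. -/
lemma norm_sub_le_of_inner_le_zero {p q a b : EuclideanSpace ℝ (Fin n)}
    (h1 : ⟪p - a, b - a⟫ ≤ 0) (h2 : ⟪q - b, a - b⟫ ≤ 0) : ‖a - b‖ ≤ ‖p - q‖ := by
  have h3 : ‖a - b‖ ^ 2 ≤ ⟪p - q, a - b⟫ := by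
    have : ⟪p - q, a - b⟫ = ⟪a - b, a - b⟫ - ⟪p - a, b - a⟫ - ⟪q - b, a - b⟫ := by
      rw [← neg_sub a b, inner_neg_right, ← sub_eq_zero]
      simp only [inner_sub_left]
      ring
    rw [this, real_inner_self_eq_norm_sq]
    linarith
  have h4 := real_inner_le_norm (p - q) (a - b)
  by_contra! h
  nlinarith [norm_nonneg (p - q)]

/-- The metric projection onto a nonempty closed convex set. -/
lemma exists_projection (hQ : Convex ℝ Q) (hc : IsClosed Q) (hne : Q.Nonempty) :
    ∃ π : EuclideanSpace ℝ (Fin n) → EuclideanSpace ℝ (Fin n), LipschitzWith 1 π ∧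
      ∀ p, ∀ a ∈ Q, (∀ y ∈ Q, ⟪p - a, y - a⟫ ≤ 0) → a = π p := by
  choose π hπ hπ' using fun p => exists_norm_eq_iInf_of_complete_convex hne hc.isComplete hQ p
  have hv : ∀ p, ∀ y ∈ Q, ⟪p - π p, y - π p⟫ ≤ 0 := fun p =>
    (norm_eq_iInf_iff_real_inner_le_zero hQ (hπ p)).1 (hπ' p)
  refine ⟨π, LipschitzWith.of_dist_le_mul fun p q => ?_, fun p a ha h => ?_⟩
  · rw [dist_eq_norm, dist_eq_norm, NNReal.coe_one, one_mul]
    exact norm_sub_le_of_inner_le_zero (hv p _ (hπ q)) (hv q _ (hπ p))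
  · have := norm_sub_le_of_inner_le_zero (h _ (hπ p)) (hv p _ ha)
    rw [sub_self, norm_zero, norm_le_zero_iff, sub_eq_zero] at this
    exact this

end Convex

/-! ### The quadratic structure of ψ_k. -/

section Psi

variable {n : ℕ}

/-- The linear coefficient of the quadratic function `psi f L m xt g k`. -/
noncomputable def psiCenter (L m : ℝ) (xt g : ℕ → EuclideanSpace ℝ (Fin n)) : ℕ → EuclideanSpace ℝ (Fin n)
  | 0 => xt 0 + seqα L m 0 • (m • xt 0 - g 0)
  | k + 1 => psiCenter L m xt g k + seqα L m (k + 1) • (m • xt (k + 1) - g (k + 1))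

/-- The curvature 1 + mA_k drives the convergence estimate, and the linear coefficient exhibits z_k
as a projection, hence as measurable. The constant b plays no role in either. -/
lemma exists_psi_eq (f : EuclideanSpace ℝ (Fin n) → ℝ) (L m : ℝ)
    (xt g : ℕ → EuclideanSpace ℝ (Fin n)) (k : ℕ) :
    ∃ b, psi f L m xt g k = fun y =>
      (1 + m * seqA L m k) / 2 * ‖y‖ ^ 2 - ⟪psiCenter L m xt g k, y⟫ + b := by
  have hmodel : ∀ a u v y, a * model f m u v y
      = a * m / 2 * ‖y‖ ^ 2 - ⟪a • (m • u - v), y⟫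
        + a * (f u - ⟪v, u⟫ + m / 2 * ‖u‖ ^ 2) := by
    intro a u v y
    rw [model, inner_sub_right, norm_sub_sq_real, real_inner_smul_left, inner_sub_left,
      real_inner_smul_left, real_inner_comm u y]
    ring
  induction k with
  | zero =>
    refine ⟨1 / 2 * ‖xt 0‖ ^ 2 +
      seqα L m 0 * (f (xt 0) - ⟪g 0, xt 0⟫ + m / 2 * ‖xt 0‖ ^ 2), funext fun y => ?_⟩
    rw [psi, hmodel, psiCenter, inner_add_left, norm_sub_sq_real, real_inner_comm (xt 0) y,
      show seqα L m 0 = seqA L m 0 from rfl]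
    ring
  | succ k ih =>
    obtain ⟨b, hb⟩ := ih
    refine ⟨b + seqα L m (k + 1) * (f (xt (k + 1)) - ⟪g (k + 1), xt (k + 1)⟫ +
      m / 2 * ‖xt (k + 1)‖ ^ 2), funext fun y => ?_⟩
    rw [psi, hmodel, psiCenter, inner_add_left, hb, seqA_succ]
    ring

lemma psi_eq_sum (f : EuclideanSpace ℝ (Fin n) → ℝ) (L m : ℝ)
    (xt g : ℕ → EuclideanSpace ℝ (Fin n)) (k : ℕ) (y : EuclideanSpace ℝ (Fin n)) :
    psi f L m xt g k y = 1 / 2 * ‖y - xt 0‖ ^ 2 +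
      ∑ j ∈ Finset.range (k + 1), seqα L m j * model f m (xt j) (g j) y := by
  induction k with
  | zero => simp [psi]
  | succ k ih => rw [psi, ih, Finset.sum_range_succ _ (k + 1), add_assoc]

end Psi

/-! ### Pathwise estimates with arbitrary gradient errors. -/

section Deterministic

variable {n : ℕ}

/-- The sequence `z` shifted by one, starting from `x₀`. -/
def prevZ (x₀ : EuclideanSpace ℝ (Fin n)) (z : ℕ → EuclideanSpace ℝ (Fin n)) :
    ℕ → EuclideanSpace ℝ (Fin n)
  | 0 => x₀
  | k + 1 => z k

variable {Q : Set (EuclideanSpace ℝ (Fin n))} {f : EuclideanSpace ℝ (Fin n) → ℝ}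
  {f' : EuclideanSpace ℝ (Fin n) → EuclideanSpace ℝ (Fin n)} {L m : ℝ}
  {x₀ : EuclideanSpace ℝ (Fin n)} {g xt z x : ℕ → EuclideanSpace ℝ (Fin n)}

namespace IsRun

lemma smul_xt_succ (h : IsRun Q f L m x₀ g xt z x) (hL : 0 < L) (hm : 0 ≤ m) (k : ℕ) :
    seqA L m (k + 1) • xt (k + 1) = seqA L m k • x k + seqα L m (k + 1) • z k := by
  rw [h.xt_succ, smul_inv_smul₀ (seqA_pos hL hm _).ne']

lemma smul_x_succ (h : IsRun Q f L m x₀ g xt z x) (hL : 0 < L) (hm : 0 ≤ m) (k : ℕ) :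
    seqA L m (k + 1) • x (k + 1) = seqA L m k • x k + seqα L m (k + 1) • z (k + 1) := by
  rw [h.x_succ, smul_inv_smul₀ (seqA_pos hL hm _).ne']

/-- The similar-triangles identity. Taking z_{-1} = x₀ extends it to k = 0, where A_0 = α_0. -/
lemma smul_x_sub_xt (h : IsRun Q f L m x₀ g xt z x) (hL : 0 < L) (hm : 0 ≤ m) (k : ℕ) :
    seqA L m k • (x k - xt k) = seqα L m k • (z k - prevZ x₀ z k) := by
  cases k with
  | zero => rw [h.x_zero, h.xt_zero]; rfl
  | succ k =>
    rw [smul_sub, smul_sub, h.smul_x_succ hL hm, h.smul_xt_succ hL hm, prevZ]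
    abel

lemma x_mem (h : IsRun Q f L m x₀ g xt z x) (hL : 0 < L) (hm : 0 ≤ m) (hQ : Convex ℝ Q)
    (k : ℕ) : x k ∈ Q := by
  induction k with
  | zero => rw [h.x_zero]; exact h.z_mem 0
  | succ k ih =>
    have hA := seqA_pos hL hm (k + 1)
    rw [h.x_succ, smul_add, smul_smul, smul_smul]
    refine hQ ih (h.z_mem (k + 1)) ?_ ?_ ?_
    · have := seqA_pos hL hm k; positivity
    · have := seqα_pos hL hm (k + 1); positivity
    · rw [← mul_add, ← seqA_succ, inv_mul_cancel₀ hA.ne']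

lemma xt_mem (h : IsRun Q f L m x₀ g xt z x) (hL : 0 < L) (hm : 0 ≤ m) (hQ : Convex ℝ Q)
    (hx₀ : x₀ ∈ Q) (k : ℕ) : xt k ∈ Q := by
  cases k with
  | zero => rw [h.xt_zero]; exact hx₀
  | succ k =>
    have hA := seqA_pos hL hm (k + 1)
    rw [h.xt_succ, smul_add, smul_smul, smul_smul]
    refine hQ (h.x_mem hL hm hQ k) (h.z_mem k) ?_ ?_ ?_
    · have := seqA_pos hL hm k; positivity
    · have := seqα_pos hL hm (k + 1); positivity
    · rw [← mul_add, ← seqA_succ, inv_mul_cancel₀ hA.ne']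

lemma psi_growth (h : IsRun Q f L m x₀ g xt z x) (hQ : Convex ℝ Q) (k : ℕ)
    {y : EuclideanSpace ℝ (Fin n)} (hy : y ∈ Q) :
    psi f L m xt g k (z k) + (1 + m * seqA L m k) / 2 * ‖y - z k‖ ^ 2 ≤ psi f L m xt g k y := by
  obtain ⟨b, hb⟩ := exists_psi_eq f L m xt g k
  have hmin := h.z_argmin k
  rw [hb] at hmin ⊢
  exact quadratic_growth_of_isMinOn hQ (h.z_mem k) hmin hy

lemma step_zero (h : IsRun Q f L m x₀ g xt z x) (hL : 0 < L) (hm : 0 ≤ m)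
    (hsm : f (x 0) ≤ f (xt 0) + ⟪f' (xt 0), x 0 - xt 0⟫ + L / 4 * ‖x 0 - xt 0‖ ^ 2) :
    seqA L m 0 * f (x 0) ≤ psi f L m xt g 0 (z 0)
      - seqA L m 0 * ⟪g 0 - f' (xt 0), x 0 - xt 0⟫
      - seqA L m 0 * (L / 4 * ‖x 0 - xt 0‖ ^ 2) := by
  have hA := seqA_pos hL hm 0
  have h1 := mul_le_mul_of_nonneg_left hsm hA.le
  have h2 : seqA L m 0 * L = 1 := by simp only [seqA]; field_simp
  have h3 : 0 ≤ seqA L m 0 * (m / 2 * ‖x 0 - xt 0‖ ^ 2) := by positivity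
  have h4 : seqA L m 0 * (L / 4 * ‖x 0 - xt 0‖ ^ 2) = 1 / 4 * ‖x 0 - xt 0‖ ^ 2 := by
    linear_combination (1 / 4 * ‖x 0 - xt 0‖ ^ 2) * h2
  rw [← h.x_zero, psi, model, inner_sub_left, show seqα L m 0 = seqA L m 0 from rfl]
  linarith

/-- Here r is the error of the inexact linear lower bound at x_k and E the error accumulated so far.
The curvature of ψ_k at z_k yields twice the quadratic term that smoothness consumes; the remainder
is kept to pay for the current noise. -/
lemma step_succ (h : IsRun Q f L m x₀ g xt z x) (hL : 0 < L) (hm : 0 ≤ m) (hQ : Convex ℝ Q)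
    (k : ℕ) {E r : ℝ}
    (hsm : f (x (k + 1)) ≤ f (xt (k + 1)) + ⟪f' (xt (k + 1)), x (k + 1) - xt (k + 1)⟫
      + L / 4 * ‖x (k + 1) - xt (k + 1)‖ ^ 2)
    (hlow : f (xt (k + 1)) + ⟪g (k + 1), x k - xt (k + 1)⟫ ≤ f (x k) + r)
    (hprev : seqA L m k * f (x k) ≤ psi f L m xt g k (z k) + E) :
    seqA L m (k + 1) * f (x (k + 1)) ≤ psi f L m xt g (k + 1) (z (k + 1))
      + E + seqA L m k * r
      - seqA L m (k + 1) * ⟪g (k + 1) - f' (xt (k + 1)), x (k + 1) - xt (k + 1)⟫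
      - seqA L m (k + 1) * (L / 4 * ‖x (k + 1) - xt (k + 1)‖ ^ 2) := by
  have hA := seqA_pos hL hm k
  have hA' := seqA_pos hL hm (k + 1)
  have ha := seqα_pos hL hm (k + 1)
  have hgrow := h.psi_growth hQ k (h.z_mem (k + 1))
  have hsq := seqα_sq_succ hL hm k
  have hdiff := h.smul_x_sub_xt hL hm (k + 1)
  rw [prevZ] at hdiff
  -- The defining equation of α_{k+1} makes the two quadratic terms match exactly.
  have hnorm : seqA L m (k + 1) * (L / 2 * ‖x (k + 1) - xt (k + 1)‖ ^ 2)
      = (1 + m * seqA L m k) / 2 * ‖z (k + 1) - z k‖ ^ 2 := by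
    have h1 := congrArg (fun v => ‖v‖ ^ 2) hdiff
    simp only [norm_smul, Real.norm_of_nonneg hA'.le, Real.norm_of_nonneg ha.le, mul_pow] at h1
    refine mul_left_cancel₀ hA'.ne' ?_
    linear_combination L / 2 * h1 - ‖z (k + 1) - z k‖ ^ 2 / 2 * hsq
  have hinner : seqA L m (k + 1) * ⟪g (k + 1), x (k + 1) - xt (k + 1)⟫
      = seqA L m k * ⟪g (k + 1), x k - xt (k + 1)⟫
        + seqα L m (k + 1) * ⟪g (k + 1), z (k + 1) - xt (k + 1)⟫ := by
    rw [← real_inner_smul_right, ← real_inner_smul_right, ← real_inner_smul_right,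
      ← inner_add_right, smul_sub, smul_sub, smul_sub, h.smul_x_succ hL hm, seqA_succ, add_smul]
    congr 1; abel
  have h1 := mul_le_mul_of_nonneg_left hsm hA'.le
  have h2 := mul_le_mul_of_nonneg_left hlow hA.le
  have h3 : 0 ≤ seqα L m (k + 1) * (m / 2 * ‖z (k + 1) - xt (k + 1)‖ ^ 2) := by positivity
  have h4 : seqA L m (k + 1) * f (xt (k + 1))
      = seqA L m k * f (xt (k + 1)) + seqα L m (k + 1) * f (xt (k + 1)) := by
    rw [seqA_succ]; ring
  rw [psi, model, inner_sub_left]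
  linarith

lemma noise_le {A L' : ℝ} (hA : 0 ≤ A) (hL : 0 < L') (e d : EuclideanSpace ℝ (Fin n)) :
    -(A * ⟪e, d⟫) - A * (L' / 4 * ‖d‖ ^ 2) ≤ A * (‖e‖ ^ 2 / L') := by
  have h1 := neg_le_of_abs_le (abs_real_inner_le_norm e d)
  have h2 : ‖e‖ * ‖d‖ ≤ ‖e‖ ^ 2 / L' + L' / 4 * ‖d‖ ^ 2 := by
    rw [← sub_nonneg]
    have : ‖e‖ ^ 2 / L' + L' / 4 * ‖d‖ ^ 2 - ‖e‖ * ‖d‖ = (‖e‖ - L' / 2 * ‖d‖) ^ 2 / L' := by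
      field_simp; ring
    rw [this]; positivity
  have h3 : -⟪e, d⟫ - L' / 4 * ‖d‖ ^ 2 ≤ ‖e‖ ^ 2 / L' := by linarith
  have := mul_le_mul_of_nonneg_left h3 hA
  linarith

lemma last_noise_le {a A κ L' : ℝ} (ha : 0 ≤ a) (hκ : 0 < κ) (hL : 0 < L')
    (haA : L' * a ^ 2 ≤ κ * A) (e d : EuclideanSpace ℝ (Fin n)) :
    a * ⟪e, d⟫ - κ / 2 * ‖d‖ ^ 2 ≤ A * (‖e‖ ^ 2 / (2 * L')) := by
  have h1 := mul_le_mul_of_nonneg_left (real_inner_le_norm e d) ha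
  have h2 : a * (‖e‖ * ‖d‖) - κ / 2 * ‖d‖ ^ 2 ≤ a ^ 2 * ‖e‖ ^ 2 / (2 * κ) := by
    rw [← sub_nonneg]
    have : a ^ 2 * ‖e‖ ^ 2 / (2 * κ) - (a * (‖e‖ * ‖d‖) - κ / 2 * ‖d‖ ^ 2)
        = (a * ‖e‖ - κ * ‖d‖) ^ 2 / (2 * κ) := by
      field_simp; ring
    rw [this]; positivity
  have h3 : a ^ 2 * ‖e‖ ^ 2 / (2 * κ) ≤ A * (‖e‖ ^ 2 / (2 * L')) := by
    rw [← mul_div_assoc, div_le_div_iff₀ (by positivity) (by positivity)]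
    have := mul_le_mul_of_nonneg_right haA (show 0 ≤ 2 * ‖e‖ ^ 2 by positivity)
    linarith
  linarith

/-- Convergence of the method when the modulus `m` is the full convexity parameter: the noise
enters through its square and through its correlation with `xs - z (k - 1)`. -/
theorem value_le_of_full_modulus (h : IsRun Q f L m x₀ g xt z x) (hL : 0 < L) (hm : 0 ≤ m)
    (hQ : Convex ℝ Q) (hx₀ : x₀ ∈ Q) (hconv : StrongConvexGrad Q f f' m)
    (hsm : ∀ k, f (x k) ≤ f (xt k) + ⟪f' (xt k), x k - xt k⟫ + L / 4 * ‖x k - xt k‖ ^ 2)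
    {xs : EuclideanSpace ℝ (Fin n)} (hxs : xs ∈ Q) (N : ℕ) :
    seqA L m N * (f (x N) - f xs) ≤ 1 / 2 * ‖x₀ - xs‖ ^ 2
      + ∑ j ∈ Finset.range N, (seqA L m j * (‖g j - f' (xt j)‖ ^ 2 / L)
          + seqα L m j * ⟪g j - f' (xt j), xs - prevZ x₀ z j⟫)
      + seqA L m N * (‖g N - f' (xt N)‖ ^ 2 / (2 * L)) := by
  have hmem := h.xt_mem hL hm hQ hx₀
  -- The noise of step k stays unestimated here. Later steps pay for it by Young's inequality, but
  -- at k = N it is combined with the error of the model at x*.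
  have key : ∀ k, seqA L m k * f (x k) ≤ psi f L m xt g k (z k)
      + ∑ j ∈ Finset.range k, (seqA L m j * (‖g j - f' (xt j)‖ ^ 2 / L)
          + seqα L m j * ⟪g j - f' (xt j), xt j - prevZ x₀ z j⟫)
      + seqα L m k * ⟪g k - f' (xt k), xt k - prevZ x₀ z k⟫
      - seqA L m k * ⟪g k - f' (xt k), x k - xt k⟫
      - seqA L m k * (L / 4 * ‖x k - xt k‖ ^ 2) := by
    intro k
    induction k with
    | zero => simpa [prevZ, h.xt_zero] using h.step_zero hL hm (hsm 0)
    | succ k ih =>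
      have hn := noise_le (seqA_pos hL hm k).le hL (g k - f' (xt k)) (x k - xt k)
      have hlow : f (xt (k + 1)) + ⟪g (k + 1), x k - xt (k + 1)⟫
          ≤ f (x k) + ⟪g (k + 1) - f' (xt (k + 1)), x k - xt (k + 1)⟫ := by
        have h1 := hconv _ (hmem (k + 1)) _ (h.x_mem hL hm hQ k)
        have : 0 ≤ m / 2 * ‖xt (k + 1) - x k‖ ^ 2 := by positivity
        rw [inner_sub_left]; linarith
      have hstep := h.step_succ hL hm hQ k (E := ∑ j ∈ Finset.range (k + 1),
        (seqA L m j * (‖g j - f' (xt j)‖ ^ 2 / L)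
          + seqα L m j * ⟪g j - f' (xt j), xt j - prevZ x₀ z j⟫)) (hsm (k + 1)) hlow
        (by rw [Finset.sum_range_succ]; linarith)
      have hinner : seqA L m k * ⟪g (k + 1) - f' (xt (k + 1)), x k - xt (k + 1)⟫
          = seqα L m (k + 1) * ⟪g (k + 1) - f' (xt (k + 1)), xt (k + 1) - z k⟫ := by
        rw [← real_inner_smul_right, ← real_inner_smul_right]
        congr 1
        have h1 := h.smul_xt_succ hL hm k
        rw [seqA_succ, add_smul] at h1
        rw [smul_sub, smul_sub, sub_eq_sub_iff_add_eq_add, ← h1, add_comm]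
      rw [hinner] at hstep
      rw [prevZ]
      linarith
  have hlast := key N
  -- The quadratic growth of ψ_N at x*, and not just minimality, is needed to absorb the last noise
  -- term.
  have hgrow := h.psi_growth hQ N hxs
  rw [psi_eq_sum] at hgrow hlast
  rw [psi_eq_sum f L m xt g N xs, h.xt_zero] at hgrow
  have hmodel : ∑ j ∈ Finset.range (N + 1), seqα L m j * model f m (xt j) (g j) xs
      ≤ seqA L m N * f xs
        + ∑ j ∈ Finset.range (N + 1), seqα L m j * ⟪g j - f' (xt j), xs - xt j⟫ := by
    rw [← sum_seqα, Finset.sum_mul, ← Finset.sum_add_distrib]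
    refine Finset.sum_le_sum fun j _ => ?_
    rw [← mul_add]
    refine mul_le_mul_of_nonneg_left ?_ (seqα_pos hL hm j).le
    have h1 := hconv _ (hmem j) _ hxs
    rw [model, inner_sub_left, norm_sub_rev xs]
    linarith
  have hsplit : ∑ j ∈ Finset.range N, (seqA L m j * (‖g j - f' (xt j)‖ ^ 2 / L)
          + seqα L m j * ⟪g j - f' (xt j), xs - prevZ x₀ z j⟫)
      = ∑ j ∈ Finset.range N, (seqA L m j * (‖g j - f' (xt j)‖ ^ 2 / L)
          + seqα L m j * ⟪g j - f' (xt j), xt j - prevZ x₀ z j⟫)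
        + ∑ j ∈ Finset.range N, seqα L m j * ⟪g j - f' (xt j), xs - xt j⟫ := by
    rw [← Finset.sum_add_distrib]
    refine Finset.sum_congr rfl fun j _ => ?_
    rw [add_assoc, ← mul_add, ← inner_add_right]
    congr 4; abel
  -- By the similar-triangles identity z_{N-1} cancels. The remaining z_N depends on ξ_N, so this
  -- term is bounded by Young's inequality and not by conditioning.
  have hend : seqα L m N * ⟪g N - f' (xt N), xt N - prevZ x₀ z N⟫
      - seqA L m N * ⟪g N - f' (xt N), x N - xt N⟫
      + seqα L m N * ⟪g N - f' (xt N), xs - xt N⟫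
      = seqα L m N * ⟪g N - f' (xt N), xs - z N⟫ := by
    rw [← real_inner_smul_right (g N - f' (xt N)) (x N - xt N), h.smul_x_sub_xt hL hm,
      real_inner_smul_right, ← mul_sub, ← mul_add, ← inner_sub_right, ← inner_add_right]
    congr 2; abel
  have hκ : 0 < 1 + m * seqA L m N := by have := seqA_pos hL hm N; positivity
  have hln := last_noise_le (seqα_pos hL hm N).le hκ hL (seqα_sq_le hL hm N)
    (g N - f' (xt N)) (xs - z N)
  have hpos : 0 ≤ seqA L m N * (L / 4 * ‖x N - xt N‖ ^ 2) := by
    have := seqA_pos hL hm N; positivity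
  rw [Finset.sum_range_succ (fun j => seqα L m j * ⟪g j - f' (xt j), xs - xt j⟫)] at hmodel
  rw [h.xt_zero] at hlast
  rw [norm_sub_rev x₀ xs]
  linarith

/-- Convergence of the method when the modulus is half of the convexity parameter `μ`: the noise
enters only through its square. -/
theorem value_le_of_half_modulus {μ : ℝ} (h : IsRun Q f L (μ / 2) x₀ g xt z x) (hL : 0 < L)
    (hμ : 0 < μ) (hQ : Convex ℝ Q) (hx₀ : x₀ ∈ Q) (hconv : StrongConvexGrad Q f f' μ)
    (hsm : ∀ k, f (x k) ≤ f (xt k) + ⟪f' (xt k), x k - xt k⟫ + L / 4 * ‖x k - xt k‖ ^ 2)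
    {xs : EuclideanSpace ℝ (Fin n)} (hxs : xs ∈ Q) (N : ℕ) :
    seqA L (μ / 2) N * (f (x N) - f xs) ≤ 1 / 2 * ‖x₀ - xs‖ ^ 2
      + ∑ j ∈ Finset.range (N + 1), seqA L (μ / 2) j *
          (‖g j - f' (xt j)‖ ^ 2 / L + ‖g j - f' (xt j)‖ ^ 2 / μ) := by
  have hm : 0 ≤ μ / 2 := by positivity
  have hmem := h.xt_mem hL hm hQ hx₀
  -- The model uses μ/4 of the available μ/2 in the quadratic term; Young's inequality spends the
  -- other μ/4 on the noise.
  have hlow : ∀ k, ∀ y ∈ Q, model f (μ / 2) (xt k) (g k) y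
      ≤ f y + ‖g k - f' (xt k)‖ ^ 2 / μ := by
    intro k y hy
    have h1 := hconv _ (hmem k) _ hy
    have h2 := noise_le zero_le_one hμ (g k - f' (xt k)) (-(y - xt k))
    rw [inner_neg_right, norm_neg, inner_sub_left] at h2
    rw [model]
    rw [norm_sub_rev] at h1
    linarith
  set m := μ / 2
  -- The weight A_j - α_j equals A_{j-1} and comes from the lower bound at x_{j-1}; the missing α_j
  -- is restored by the lower bound at x*.
  have key : ∀ k, seqA L m k * f (x k) ≤ psi f L m xt g k (z k)
      + ∑ j ∈ Finset.range (k + 1), (seqA L m j * (‖g j - f' (xt j)‖ ^ 2 / L)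
          + (seqA L m j - seqα L m j) * (‖g j - f' (xt j)‖ ^ 2 / μ)) := by
    intro k
    have hn := noise_le (seqA_pos hL hm k).le hL (g k - f' (xt k)) (x k - xt k)
    induction k with
    | zero =>
      have := h.step_zero hL hm (hsm 0)
      rw [zero_add, Finset.sum_range_one, show seqα L m 0 = seqA L m 0 from rfl, sub_self,
        zero_mul]
      linarith
    | succ k ih =>
      have hl := hlow (k + 1) _ (h.x_mem hL hm hQ k)
      rw [model] at hl
      have : 0 ≤ m / 2 * ‖x k - xt (k + 1)‖ ^ 2 := by positivity
      have hstep := h.step_succ hL hm hQ k (hsm (k + 1)) (by linarith)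
        (ih (noise_le (seqA_pos hL hm k).le hL (g k - f' (xt k)) (x k - xt k)))
      rw [Finset.sum_range_succ _ (k + 1),
        show seqA L m (k + 1) - seqα L m (k + 1) = seqA L m k by rw [seqA_succ]; ring]
      linarith
  have hlast := key N
  have hmin := isMinOn_iff.1 (h.z_argmin N) xs hxs
  rw [psi_eq_sum f L m xt g N xs, h.xt_zero] at hmin
  have hmodel : ∑ j ∈ Finset.range (N + 1), seqα L m j * model f m (xt j) (g j) xs
      ≤ seqA L m N * f xs
        + ∑ j ∈ Finset.range (N + 1), seqα L m j * (‖g j - f' (xt j)‖ ^ 2 / μ) := by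
    rw [← sum_seqα, Finset.sum_mul, ← Finset.sum_add_distrib]
    refine Finset.sum_le_sum fun j _ => ?_
    rw [← mul_add]
    exact mul_le_mul_of_nonneg_left (hlow j _ hxs) (seqα_pos hL hm j).le
  have hsplit : ∑ j ∈ Finset.range (N + 1), seqA L m j *
          (‖g j - f' (xt j)‖ ^ 2 / L + ‖g j - f' (xt j)‖ ^ 2 / μ)
      = ∑ j ∈ Finset.range (N + 1), (seqA L m j * (‖g j - f' (xt j)‖ ^ 2 / L)
          + (seqA L m j - seqα L m j) * (‖g j - f' (xt j)‖ ^ 2 / μ))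
        + ∑ j ∈ Finset.range (N + 1), seqα L m j * (‖g j - f' (xt j)‖ ^ 2 / μ) := by
    rw [← Finset.sum_add_distrib]
    refine Finset.sum_congr rfl fun j _ => ?_
    ring
  rw [norm_sub_rev xs] at hmin
  linarith

end IsRun

end Deterministic

/-! ### Measurability and conditional moment inequalities. -/

section Probability

/-- Both f and its gradient are controlled only on Q, so measurability passes through the subtype.
-/
lemma measurable_comp_of_continuousOn {Ω E F : Type*} [MeasurableSpace Ω] [TopologicalSpace E]
    [MeasurableSpace E] [BorelSpace E] [TopologicalSpace F] [MeasurableSpace F] [BorelSpace F]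
    {Q : Set E} {f : E → F} (hf : ContinuousOn f Q)
    {X : Ω → E} (hX : Measurable X) (hXQ : ∀ ω, X ω ∈ Q) : Measurable fun ω => f (X ω) :=
  (continuousOn_iff_continuous_domRestrict.1 hf).measurable.comp (hX.subtype_mk (h := hXQ))

variable {Ω : Type*} [mΩ : MeasurableSpace Ω] {P : Measure Ω} [IsProbabilityMeasure P]

lemma integral_le_of_condExp_le {m : MeasurableSpace Ω} (hm : m ≤ mΩ) {Y : Ω → ℝ} {c : ℝ}
    (h : P[Y | m] ≤ᵐ[P] fun _ => c) : ∫ ω, Y ω ∂P ≤ c := by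
  rw [← integral_condExp hm]
  simpa using integral_mono_ae integrable_condExp (integrable_const c) h

/-- Conditional Cauchy-Schwarz inequality against a nonnegative `m`-measurable weight. -/
lemma integral_norm_mul_le_of_condExp_sq_le {E : Type*} [NormedAddCommGroup E]
    {m : MeasurableSpace Ω} (hm : m ≤ mΩ) {e : Ω → E} {W : Ω → ℝ} {δ : ℝ} (hδ : 0 ≤ δ)
    (he : MemLp e 2 P) (hcond : P[fun ω => ‖e ω‖ ^ 2 | m] ≤ᵐ[P] fun _ => δ ^ 2)
    (hW : Measurable[m] W) (hW2 : MemLp W 2 P) (hW0 : ∀ ω, 0 ≤ W ω) :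
    ∫ ω, W ω * ‖e ω‖ ∂P ≤ δ * ∫ ω, W ω ∂P := by
  have hen : Integrable (fun ω => ‖e ω‖) P := he.norm.integrable one_le_two
  have hWi : Integrable W P := hW2.integrable one_le_two
  have hesq : Integrable (fun ω => ‖e ω‖ ^ 2) P := he.integrable_norm_pow two_ne_zero
  have hprod : Integrable (W * fun ω => ‖e ω‖) P := hW2.integrable_mul he.norm
  have hWpos : 0 ≤ ∫ ω, W ω ∂P := integral_nonneg hW0
  -- Young's inequality ‖e‖ ≤ ‖e‖²/(2t) + t/2 linearizes the square root, so only monotonicity and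
  -- linearity of conditional expectation are needed.
  have key : ∀ t : ℝ, 0 < t →
      ∫ ω, W ω * ‖e ω‖ ∂P ≤ (δ ^ 2 / (2 * t) + t / 2) * ∫ ω, W ω ∂P := by
    intro t ht
    have hle : (fun ω => ‖e ω‖) ≤ᵐ[P] (fun ω => (1 / (2 * t)) * ‖e ω‖ ^ 2) + fun _ => t / 2 := by
      refine Filter.Eventually.of_forall fun ω => ?_
      simp only [Pi.add_apply]
      rw [← sub_nonneg]
      have : 1 / (2 * t) * ‖e ω‖ ^ 2 + t / 2 - ‖e ω‖ = (‖e ω‖ - t) ^ 2 / (2 * t) := by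
        field_simp; ring
      rw [this]; positivity
    have h1 := condExp_mono (m := m) hen ((hesq.const_mul _).add (integrable_const _)) hle
    have h2 := condExp_add (hesq.const_mul (1 / (2 * t))) (integrable_const (μ := P) (t / 2)) m
    have h3 := condExp_smul (μ := P) (1 / (2 * t)) (fun ω => ‖e ω‖ ^ 2) m
    have h4 := condExp_mul_of_stronglyMeasurable_left (μ := P) hW.stronglyMeasurable hprod hen
    have h5 : ∫ ω, W ω * ‖e ω‖ ∂P = ∫ ω, (W * P[fun ω => ‖e ω‖ | m]) ω ∂P := by
      rw [← integral_congr_ae h4, integral_condExp hm]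
      rfl
    rw [h5, ← integral_const_mul]
    refine integral_mono_ae (integrable_condExp.congr h4) (hWi.const_mul _) ?_
    filter_upwards [h1, h2, h3, hcond] with ω k1 k2 k3 k4
    rw [k2] at k1
    simp only [Pi.add_apply, condExp_const hm] at k1
    have k3' : P[fun ω => 1 / (2 * t) * ‖e ω‖ ^ 2 | m] ω
        = 1 / (2 * t) * P[fun ω => ‖e ω‖ ^ 2 | m] ω := k3
    rw [k3'] at k1
    rw [Pi.mul_apply, mul_comm]
    refine mul_le_mul_of_nonneg_right (k1.trans ?_) (hW0 ω)
    rw [div_eq_mul_one_div (δ ^ 2), mul_comm (δ ^ 2)]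
    gcongr
  refine le_of_forall_pos_le_add fun ε hε => ?_
  have hI : 0 < (∫ ω, W ω ∂P) + 1 := by linarith
  set I := ∫ ω, W ω ∂P
  -- The optimal t = δ may vanish; the perturbation costs at most ε after multiplication by I.
  have ht : 0 < δ + ε / (I + 1) := by positivity
  refine (key _ ht).trans ?_
  have h1 : δ ^ 2 / (2 * (δ + ε / (I + 1))) ≤ δ / 2 := by
    rw [div_le_div_iff₀ (by positivity) two_pos]
    have : 0 ≤ δ * (ε / (I + 1)) := by positivity
    nlinarith
  have h2 : ε / (I + 1) * I ≤ ε := by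
    rw [div_mul_eq_mul_div, div_le_iff₀ hI]; nlinarith
  have h3 := mul_le_mul_of_nonneg_right h1 hWpos
  have h4 : 0 ≤ ε / (I + 1) * I := by positivity
  nlinarith

end Probability

/-! ### Adaptedness and square integrability of the iterates. -/

section Regularity

variable {n : ℕ} {Ω Ξ : Type*} [mΩ : MeasurableSpace Ω] [MeasurableSpace Ξ]
  {P : Measure Ω} {ℱ : Filtration ℕ mΩ}
  {Q : Set (EuclideanSpace ℝ (Fin n))} {f : EuclideanSpace ℝ (Fin n) → ℝ}
  {f' : EuclideanSpace ℝ (Fin n) → EuclideanSpace ℝ (Fin n)} {Lf L m δ : ℝ}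
  {G : EuclideanSpace ℝ (Fin n) → Ξ → EuclideanSpace ℝ (Fin n)}
  {ξ : ℕ → Ω → Ξ} {x₀ : EuclideanSpace ℝ (Fin n)}
  {xt z x : ℕ → Ω → EuclideanSpace ℝ (Fin n)}

/-- A random vector which is measurable for `m` and square integrable for `P`. -/
def SqIntegrable {n : ℕ} {Ω : Type*} {mΩ : MeasurableSpace Ω} (P : Measure Ω)
    (m : MeasurableSpace Ω) (X : Ω → EuclideanSpace ℝ (Fin n)) : Prop :=
  Measurable[m] X ∧ MemLp X 2 P

namespace SqIntegrable

variable {𝓜 : MeasurableSpace Ω} {X Y : Ω → EuclideanSpace ℝ (Fin n)}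

lemma mono {𝓜' : MeasurableSpace Ω} (h : 𝓜 ≤ 𝓜') (hX : SqIntegrable P 𝓜 X) :
    SqIntegrable P 𝓜' X := ⟨hX.1.mono h le_rfl, hX.2⟩

lemma add (hX : SqIntegrable P 𝓜 X) (hY : SqIntegrable P 𝓜 Y) :
    SqIntegrable P 𝓜 fun ω => X ω + Y ω :=
  ⟨hX.1.add hY.1, hX.2.add hY.2⟩

lemma sub (hX : SqIntegrable P 𝓜 X) (hY : SqIntegrable P 𝓜 Y) :
    SqIntegrable P 𝓜 fun ω => X ω - Y ω :=
  ⟨hX.1.sub hY.1, hX.2.sub hY.2⟩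

lemma smul (a : ℝ) (hX : SqIntegrable P 𝓜 X) : SqIntegrable P 𝓜 fun ω => a • X ω :=
  ⟨hX.1.const_smul a, hX.2.const_smul a⟩

variable [IsProbabilityMeasure P]

lemma const (v : EuclideanSpace ℝ (Fin n)) : SqIntegrable P 𝓜 fun _ : Ω => v :=
  ⟨@measurable_const _ _ _ 𝓜 v, memLp_const v⟩

lemma comp_of_lipschitzOn (h𝓜 : 𝓜 ≤ mΩ) (hX : SqIntegrable P 𝓜 X) {K : ℝ}
    {φ : EuclideanSpace ℝ (Fin n) → EuclideanSpace ℝ (Fin n)} (hφ : ContinuousOn φ Q)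
    (hlip : ∀ u ∈ Q, ∀ v ∈ Q, ‖φ u - φ v‖ ≤ K * ‖u - v‖) {v : EuclideanSpace ℝ (Fin n)}
    (hv : v ∈ Q) (hXQ : ∀ ω, X ω ∈ Q) : SqIntegrable P 𝓜 fun ω => φ (X ω) := by
  have hmeas := @measurable_comp_of_continuousOn _ _ _ 𝓜 _ _ _ _ _ _ _ _ hφ _ hX.1 hXQ
  refine ⟨hmeas, ?_⟩
  have h1 : MemLp (fun ω => φ (X ω) - φ v) 2 P :=
    (hX.2.sub (memLp_const v)).of_le_mul
      ((hmeas.mono h𝓜 le_rfl).sub measurable_const).aestronglyMeasurable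
      (Filter.Eventually.of_forall fun ω => hlip _ (hXQ ω) _ hv)
  convert! h1.add (memLp_const (φ v)) using 1
  funext ω
  simp

end SqIntegrable

lemma BoundedNoise.sqIntegrable_noise (hnoise : BoundedNoise P ℱ Q f' G ξ δ)
    (hG : Measurable (Function.uncurry G)) (hξ : ∀ k, Measurable[ℱ (k + 1)] (ξ k))
    (hLf : 0 ≤ Lf) (hsmooth : SmoothOn Q f f' Lf)
    {k : ℕ} {X : Ω → EuclideanSpace ℝ (Fin n)} (hX : Measurable[ℱ k] X) (hXQ : ∀ ω, X ω ∈ Q) :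
    SqIntegrable P (ℱ (k + 1)) fun ω => G (X ω) (ξ k ω) - f' (X ω) := by
  have hX' : Measurable[ℱ (k + 1)] X := hX.mono (ℱ.mono k.le_succ) le_rfl
  have h1 : Measurable[ℱ (k + 1)] fun ω => G (X ω) (ξ k ω) := hG.comp (hX'.prodMk (hξ k))
  have h2 : Measurable[ℱ (k + 1)] fun ω => f' (X ω) :=
    @measurable_comp_of_continuousOn _ _ _ (ℱ (k + 1)) _ _ _ _ _ _ _ _
      (hsmooth.continuousOn_gradient hLf) _ hX' hXQ
  have h3 : Measurable[ℱ (k + 1)] fun ω => G (X ω) (ξ k ω) - f' (X ω) := h1.sub h2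
  refine ⟨h3, ?_⟩
  rw [memLp_two_iff_integrable_sq_norm (h3.mono (ℱ.le _) le_rfl).aestronglyMeasurable]
  exact (hnoise k X hX hXQ).1

/-- The index shift is essential: x̃_k is known before ξ_k, while z_k and x_k use it. Square
integrability propagates because gradient and projection are Lipschitz and the noise has finite
second moment. -/
lemma IsStochasticRun.sqIntegrable [IsProbabilityMeasure P]
    (hrun : IsStochasticRun Q f G ξ L m x₀ xt z x)
    (hL : 0 < L) (hm : 0 ≤ m) (hQ : Convex ℝ Q) (hc : IsClosed Q) (hx₀ : x₀ ∈ Q)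
    (hnoise : BoundedNoise P ℱ Q f' G ξ δ)
    (hG : Measurable (Function.uncurry G)) (hξ : ∀ k, Measurable[ℱ (k + 1)] (ξ k))
    (hLf : 0 ≤ Lf) (hsmooth : SmoothOn Q f f' Lf) (k : ℕ) :
    SqIntegrable P (ℱ k) (xt k) ∧ SqIntegrable P (ℱ (k + 1)) (z k) ∧
      SqIntegrable P (ℱ (k + 1)) (x k) := by
  obtain ⟨π, hπ, hproj⟩ := exists_projection hQ hc ⟨x₀, hx₀⟩
  let c : ℕ → Ω → EuclideanSpace ℝ (Fin n) := fun k ω =>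
    psiCenter L m (fun k => xt k ω) (fun k => G (xt k ω) (ξ k ω)) k
  have hxtQ : ∀ k ω, xt k ω ∈ Q := fun k ω => (hrun ω).xt_mem hL hm hQ hx₀ k
  have hxt0 : xt 0 = fun _ => x₀ := funext fun ω => (hrun ω).xt_zero
  have hgrad : ∀ k, SqIntegrable P (ℱ k) (xt k) →
      SqIntegrable P (ℱ (k + 1)) fun ω => m • xt k ω - G (xt k ω) (ξ k ω) := by
    intro k hk
    have h1 := hnoise.sqIntegrable_noise hG hξ hLf hsmooth hk.1 (hxtQ k)
    have hk' := hk.mono (ℱ.mono k.le_succ)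
    have h2 := hk'.comp_of_lipschitzOn (ℱ.le _) (hsmooth.continuousOn_gradient hLf)
      hsmooth.2 hx₀ (hxtQ k)
    simpa using (hk'.smul m).sub (h1.add h2)
  have hz : ∀ k, SqIntegrable P (ℱ (k + 1)) (c k) → SqIntegrable P (ℱ (k + 1)) (z k) := by
    intro k hck
    have hκ : 0 < 1 + m * seqA L m k := by have := seqA_pos hL hm k; positivity
    -- Completing the square turns the minimizer of ψ_k into the projection of its rescaled linear
    -- coefficient.
    have hzk : z k = fun ω => π ((1 + m * seqA L m k)⁻¹ • c k ω) := by
      funext ω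
      refine hproj _ _ ((hrun ω).z_mem k) fun y hy => ?_
      obtain ⟨b, hb⟩ := exists_psi_eq f L m (fun k => xt k ω) (fun k => G (xt k ω) (ξ k ω)) k
      have hmin := (hrun ω).z_argmin k
      rw [hb] at hmin
      have h1 := inner_le_zero_of_isMinOn_quadratic hQ ((hrun ω).z_mem k) hmin hy
      have h2 : (1 + m * seqA L m k)⁻¹ • c k ω - z k ω
          = (1 + m * seqA L m k)⁻¹ • (c k ω - (1 + m * seqA L m k) • z k ω) := by
        rw [smul_sub, inv_smul_smul₀ hκ.ne']
      rw [h2, real_inner_smul_left]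
      exact mul_nonpos_of_nonneg_of_nonpos (by positivity) h1
    rw [hzk]
    refine (hck.smul _).comp_of_lipschitzOn (Q := Set.univ) (K := 1) (ℱ.le _)
      hπ.continuous.continuousOn (fun u _ v _ => ?_) (Set.mem_univ 0) fun _ => Set.mem_univ _
    simpa [dist_eq_norm] using hπ.dist_le_mul u v
  have key : SqIntegrable P (ℱ k) (xt k) ∧ SqIntegrable P (ℱ (k + 1)) (c k) ∧
      SqIntegrable P (ℱ (k + 1)) (x k) := by
    induction k with
    | zero =>
      have h0 : SqIntegrable P (ℱ 0) (xt 0) := by rw [hxt0]; exact SqIntegrable.const x₀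
      have hc0 : SqIntegrable P (ℱ (0 + 1)) (c 0) :=
        (h0.mono (ℱ.mono (Nat.zero_le _))).add ((hgrad 0 h0).smul _)
      refine ⟨h0, hc0, ?_⟩
      rw [show x 0 = z 0 from funext fun ω => (hrun ω).x_zero]
      exact hz 0 hc0
    | succ k ih =>
      obtain ⟨-, ihc, ihx⟩ := ih
      have h0 : SqIntegrable P (ℱ (k + 1)) (xt (k + 1)) := by
        rw [show xt (k + 1) = _ from funext fun ω => (hrun ω).xt_succ k]
        exact ((ihx.smul _).add ((hz k ihc).smul _)).smul _
      have hle : ℱ (k + 1) ≤ ℱ (k + 1 + 1) := ℱ.mono (Nat.le_succ _)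
      have hcs : SqIntegrable P (ℱ (k + 1 + 1)) (c (k + 1)) :=
        (ihc.mono hle).add ((hgrad (k + 1) h0).smul _)
      refine ⟨h0, hcs, ?_⟩
      rw [show x (k + 1) = _ from funext fun ω => (hrun ω).x_succ k]
      exact (((ihx.mono hle).smul _).add ((hz (k + 1) hcs).smul _)).smul _
  exact ⟨key.1, hz k key.2.1, key.2.2⟩

end Regularity

/-! ### Estimates in expectation. -/

section Expectation

/-- The random variable `Y` is integrable with mean at most `c`. -/
def MeanLE {Ω : Type*} {mΩ : MeasurableSpace Ω} (P : Measure Ω) (Y : Ω → ℝ) (c : ℝ) : Prop :=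
  Integrable Y P ∧ ∫ ω, Y ω ∂P ≤ c

namespace MeanLE

variable {Ω : Type*} {mΩ : MeasurableSpace Ω} {P : Measure Ω} {Y Z : Ω → ℝ} {a b : ℝ}

lemma add (hY : MeanLE P Y a) (hZ : MeanLE P Z b) : MeanLE P (fun ω => Y ω + Z ω) (a + b) :=
  ⟨hY.1.add hZ.1, by rw [integral_add hY.1 hZ.1]; exact add_le_add hY.2 hZ.2⟩

lemma const_mul (hY : MeanLE P Y a) {t : ℝ} (ht : 0 ≤ t) :
    MeanLE P (fun ω => t * Y ω) (t * a) :=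
  ⟨hY.1.const_mul t, by rw [integral_const_mul]; exact mul_le_mul_of_nonneg_left hY.2 ht⟩

lemma div_const (hY : MeanLE P Y a) {t : ℝ} (ht : 0 ≤ t) :
    MeanLE P (fun ω => Y ω / t) (a / t) := by
  simpa only [div_eq_inv_mul] using hY.const_mul (inv_nonneg.2 ht)

lemma const [IsProbabilityMeasure P] (t : ℝ) : MeanLE P (fun _ => t) t :=
  ⟨integrable_const t, by simp⟩

lemma sum {N : ℕ} {Y : ℕ → Ω → ℝ} {a : ℕ → ℝ} (h : ∀ j < N, MeanLE P (Y j) (a j)) :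
    MeanLE P (fun ω => ∑ j ∈ Finset.range N, Y j ω) (∑ j ∈ Finset.range N, a j) := by
  have hi : ∀ j ∈ Finset.range N, Integrable (Y j) P := fun j hj =>
    (h j (Finset.mem_range.1 hj)).1
  refine ⟨integrable_finsetSum _ hi, ?_⟩
  rw [integral_finsetSum _ hi]
  exact Finset.sum_le_sum fun j hj => (h j (Finset.mem_range.1 hj)).2

lemma mul_integral_sub_le [IsProbabilityMeasure P] (hZ : MeanLE P Z a) (hY : Integrable Y P)
    {t c : ℝ} (h : ∀ ω, t * (Y ω - c) ≤ Z ω) : t * ((∫ ω, Y ω ∂P) - c) ≤ a := by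
  have h1 : ∫ ω, t * (Y ω - c) ∂P ≤ ∫ ω, Z ω ∂P :=
    integral_mono ((hY.sub (integrable_const c)).const_mul t) hZ.1 h
  rw [integral_const_mul, integral_sub hY (integrable_const c)] at h1
  simp only [integral_const, probReal_univ, one_smul] at h1
  exact h1.trans hZ.2

end MeanLE

variable {n : ℕ} {Ω Ξ : Type*} [mΩ : MeasurableSpace Ω]
  {P : Measure Ω} {ℱ : Filtration ℕ mΩ}
  {Q : Set (EuclideanSpace ℝ (Fin n))} {f : EuclideanSpace ℝ (Fin n) → ℝ}
  {f' : EuclideanSpace ℝ (Fin n) → EuclideanSpace ℝ (Fin n)} {Lf L μ m δ : ℝ}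
  {G : EuclideanSpace ℝ (Fin n) → Ξ → EuclideanSpace ℝ (Fin n)}
  {ξ : ℕ → Ω → Ξ} {x₀ xs : EuclideanSpace ℝ (Fin n)}
  {xt z x : ℕ → Ω → EuclideanSpace ℝ (Fin n)}

lemma maxExpDist_nonneg (N : ℕ) : 0 ≤ maxExpDist P xs xt z x N :=
  (integral_nonneg fun _ => norm_nonneg _).trans
    ((le_max_left _ _).trans (Finset.le_sup' (fun j => max (∫ ω, ‖z j ω - xs‖ ∂P)
      (max (∫ ω, ‖x j ω - xs‖ ∂P) (∫ ω, ‖xt j ω - xs‖ ∂P))) (Finset.mem_range.2 N.succ_pos)))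

lemma integral_prevZ_le_maxExpDist (hxt : ∀ ω, xt 0 ω = x₀) {j N : ℕ} (hj : j ≤ N) :
    ∫ ω, ‖prevZ x₀ (fun k => z k ω) j - xs‖ ∂P ≤ maxExpDist P xs xt z x N := by
  have key : ∀ i ≤ N, max (∫ ω, ‖z i ω - xs‖ ∂P)
      (max (∫ ω, ‖x i ω - xs‖ ∂P) (∫ ω, ‖xt i ω - xs‖ ∂P)) ≤ maxExpDist P xs xt z x N :=
    fun i hi => Finset.le_sup' (fun j => max (∫ ω, ‖z j ω - xs‖ ∂P)
      (max (∫ ω, ‖x j ω - xs‖ ∂P) (∫ ω, ‖xt j ω - xs‖ ∂P)))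
      (Finset.mem_range.2 (Nat.lt_succ_of_le hi))
  cases j with
  | zero =>
    refine le_trans (le_of_eq ?_) (((le_max_right _ _).trans (le_max_right _ _)).trans (key 0 hj))
    simp only [prevZ, hxt]
  | succ j => exact (le_max_left _ _).trans (key j (by omega))

lemma half_sq_div_seqA_le (hL : 0 < L) (hm : 0 ≤ m) (hmL : m ≤ L) {r R : ℝ} (hr : 0 ≤ r)
    (hR : r ≤ R) (N : ℕ) :
    1 / 2 * r ^ 2 ≤ seqA L m N *
      (L * R ^ 2 * Real.exp (-(1 / 2) * Real.sqrt (m / L) * N)) := by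
  have h1 := exp_le_seqA hL hm hmL N
  have h2 : 0 ≤ L * R ^ 2 * Real.exp (-(1 / 2) * Real.sqrt (m / L) * N) := by positivity
  refine le_trans ?_ (mul_le_mul_of_nonneg_right h1 h2)
  have h3 : Real.exp (1 / 2 * Real.sqrt (m / L) * N) *
      Real.exp (-(1 / 2) * Real.sqrt (m / L) * N) = 1 := by
    rw [← Real.exp_add]; ring_nf; simp
  have h4 : 1 / L * Real.exp (1 / 2 * Real.sqrt (m / L) * N) *
      (L * R ^ 2 * Real.exp (-(1 / 2) * Real.sqrt (m / L) * N)) = R ^ 2 := by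
    calc _ = (1 / L * L) * R ^ 2 * (Real.exp (1 / 2 * Real.sqrt (m / L) * N) *
      Real.exp (-(1 / 2) * Real.sqrt (m / L) * N)) := by ring
      _ = R ^ 2 := by rw [h3, one_div_mul_cancel hL.ne']; ring
  rw [h4]
  nlinarith

variable [IsProbabilityMeasure P]

lemma meanLE_sq_noise (hnoise : BoundedNoise P ℱ Q f' G ξ δ) {k : ℕ}
    {X : Ω → EuclideanSpace ℝ (Fin n)} (hX : Measurable[ℱ k] X) (hXQ : ∀ ω, X ω ∈ Q) :
    MeanLE P (fun ω => ‖G (X ω) (ξ k ω) - f' (X ω)‖ ^ 2) (δ ^ 2) :=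
  ⟨(hnoise k X hX hXQ).1, integral_le_of_condExp_le (ℱ.le k) (hnoise k X hX hXQ).2⟩

lemma IsStochasticRun.integral_eq_of_subsingleton
    (hrun : IsStochasticRun Q f G ξ L m x₀ xt z x) (hL : 0 < L) (hm : 0 ≤ m) (hQ : Convex ℝ Q)
    (hxs : xs ∈ Q) (hsub : Q.Subsingleton) (N : ℕ) : ∫ ω, f (x N ω) ∂P = f xs := by
  have : ∀ ω, x N ω = xs := fun ω => hsub ((hrun ω).x_mem hL hm hQ N) hxs
  simp [this]

variable [MeasurableSpace Ξ]

/-- On Q, f lies between f(x*) and the smoothness quadratic at x*, so square integrability of x_k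
suffices. -/
lemma IsStochasticRun.hasExpectations (hrun : IsStochasticRun Q f G ξ L m x₀ xt z x)
    (hL : 0 < L) (hm : 0 ≤ m) (hQ : Convex ℝ Q) (hc : IsClosed Q) (hx₀ : x₀ ∈ Q)
    (hnoise : BoundedNoise P ℱ Q f' G ξ δ)
    (hG : Measurable (Function.uncurry G)) (hξ : ∀ k, Measurable[ℱ (k + 1)] (ξ k))
    (hLf : 0 ≤ Lf) (hsmooth : SmoothOn Q f f' Lf) (hxs : xs ∈ Q) (hmin : IsMinOn f Q xs) :
    HasExpectations P f xs xt z x := by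
  intro k
  obtain ⟨h1, h2, h3⟩ := hrun.sqIntegrable hL hm hQ hc hx₀ hnoise hG hξ hLf hsmooth k
  have hxQ : ∀ ω, x k ω ∈ Q := fun ω => (hrun ω).x_mem hL hm hQ k
  have hdist : ∀ {X : Ω → EuclideanSpace ℝ (Fin n)}, MemLp X 2 P →
      MemLp (fun ω => X ω - xs) 2 P := fun hX => hX.sub (memLp_const xs)
  have hnorm : ∀ {X : Ω → EuclideanSpace ℝ (Fin n)}, MemLp X 2 P →
      Integrable (fun ω => ‖X ω - xs‖) P := fun hX => ((hdist hX).norm).integrable one_le_two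
  refine ⟨?_, hnorm h2.2, hnorm h3.2, hnorm h1.2⟩
  have hsq : Integrable (fun ω => ‖x k ω - xs‖ ^ 2) P :=
    (hdist h3.2).integrable_norm_pow two_ne_zero
  have hmeas : Measurable fun ω => f (x k ω) :=
    measurable_comp_of_continuousOn hsmooth.continuousOn (h3.1.mono (ℱ.le _) le_rfl) hxQ
  refine Integrable.mono' (((integrable_const |f xs|).add ((hnorm h3.2).const_mul ‖f' xs‖)).add
    (hsq.const_mul (Lf / 2))) hmeas.aestronglyMeasurable (Filter.Eventually.of_forall fun ω => ?_)
  have k1 := isMinOn_iff.1 hmin _ (hxQ ω)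
  have k2 := hsmooth.le_quadratic hQ hxs (hxQ ω)
  have k3 := real_inner_le_norm (f' xs) (x k ω - xs)
  have k4 : 0 ≤ ‖f' xs‖ * ‖x k ω - xs‖ := by positivity
  have k5 : 0 ≤ Lf / 2 * ‖x k ω - xs‖ ^ 2 := by positivity
  simp only [Pi.add_apply, Real.norm_eq_abs]
  rw [abs_le]
  constructor
  · linarith [neg_abs_le (f xs)]
  · linarith [le_abs_self (f xs)]

/-- Meant for Y = z_{k-1}: being known at time k, it can be held fixed while the noise is averaged,
so first moments of its distance to x* are enough. -/
lemma meanLE_inner_noise (hδ : 0 ≤ δ) (hnoise : BoundedNoise P ℱ Q f' G ξ δ)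
    (hG : Measurable (Function.uncurry G)) (hξ : ∀ k, Measurable[ℱ (k + 1)] (ξ k))
    (hLf : 0 ≤ Lf) (hsmooth : SmoothOn Q f f' Lf) {k : ℕ}
    {X Y : Ω → EuclideanSpace ℝ (Fin n)} (hX : Measurable[ℱ k] X) (hXQ : ∀ ω, X ω ∈ Q)
    (hY : SqIntegrable P (ℱ k) Y) :
    MeanLE P (fun ω => ⟪G (X ω) (ξ k ω) - f' (X ω), xs - Y ω⟫) (δ * ∫ ω, ‖Y ω - xs‖ ∂P) := by
  have he := hnoise.sqIntegrable_noise hG hξ hLf hsmooth hX hXQ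
  have hW := hY.sub (SqIntegrable.const xs)
  have hWm : Measurable[ℱ k] fun ω => ‖Y ω - xs‖ := measurable_norm.comp hW.1
  have hint : Integrable (fun ω => ⟪G (X ω) (ξ k ω) - f' (X ω), xs - Y ω⟫) P := by
    refine Integrable.mono' (hW.2.norm.integrable_mul he.2.norm)
      ((he.2.aestronglyMeasurable).inner ((aestronglyMeasurable_const).sub
        hY.2.aestronglyMeasurable)) (Filter.Eventually.of_forall fun ω => ?_)
    refine (norm_inner_le_norm _ _).trans (le_of_eq ?_)
    rw [norm_sub_rev xs, mul_comm]; rfl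
  refine ⟨hint, ?_⟩
  refine le_trans (integral_mono hint (hW.2.norm.integrable_mul he.2.norm) fun ω => ?_)
    (integral_norm_mul_le_of_condExp_sq_le (ℱ.le k) hδ he.2 (hnoise k X hX hXQ).2 hWm hW.2.norm
      fun _ => norm_nonneg _)
  refine (real_inner_le_norm _ _).trans (le_of_eq ?_)
  rw [norm_sub_rev xs, mul_comm]; rfl

/-- Expected value of the objective when the modulus is the full convexity parameter. -/
theorem IsStochasticRun.expected_value_le_of_full_modulus
    (hrun : IsStochasticRun Q f G ξ L m x₀ xt z x)
    (hL : L = 2 * Lf) (hLf : 0 < Lf) (hm : 0 ≤ m) (hδ : 0 ≤ δ) (hQ : Convex ℝ Q)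
    (hc : IsClosed Q) (hx₀ : x₀ ∈ Q) (hnoise : BoundedNoise P ℱ Q f' G ξ δ)
    (hG : Measurable (Function.uncurry G)) (hξ : ∀ k, Measurable[ℱ (k + 1)] (ξ k))
    (hsmooth : SmoothOn Q f f' Lf) (hconv : StrongConvexGrad Q f f' m)
    (hxs : xs ∈ Q) (hmin : IsMinOn f Q xs) (N : ℕ) :
    seqA L m N * ((∫ ω, f (x N ω) ∂P) - f xs) ≤ 1 / 2 * ‖x₀ - xs‖ ^ 2
      + (∑ j ∈ Finset.range N, seqA L m j + seqA L m N / 2) * (δ ^ 2 / L)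
      + seqA L m N * (maxExpDist P xs xt z x N * δ) := by
  have hL0 : 0 < L := by linarith
  have hreg := hrun.sqIntegrable hL0 hm hQ hc hx₀ hnoise hG hξ hLf.le hsmooth
  have hxtQ : ∀ k ω, xt k ω ∈ Q := fun k ω => (hrun ω).xt_mem hL0 hm hQ hx₀ k
  have hexp := hrun.hasExpectations hL0 hm hQ hc hx₀ hnoise hG hξ hLf.le hsmooth hxs hmin
  have hprev : ∀ j, SqIntegrable P (ℱ j) fun ω => prevZ x₀ (fun k => z k ω) j := by
    intro j
    cases j with
    | zero => exact SqIntegrable.const x₀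
    | succ j => exact (hreg j).2.1
  have hdet := fun ω => (hrun ω).value_le_of_full_modulus hL0 hm hQ hx₀ hconv (fun k => by
    have h := hsmooth.le_quadratic hQ (hxtQ k ω) ((hrun ω).x_mem hL0 hm hQ k)
    rwa [show Lf / 2 = L / 4 by rw [hL]; ring] at h) hxs N
  have hsq : ∀ j, MeanLE P (fun ω => ‖G (xt j ω) (ξ j ω) - f' (xt j ω)‖ ^ 2) (δ ^ 2) :=
    fun j => meanLE_sq_noise hnoise (hreg j).1.1 (hxtQ j)
  have hmean := ((MeanLE.const (P := P) (1 / 2 * ‖x₀ - xs‖ ^ 2)).add (MeanLE.sum (N := N)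
    fun j _ => (((hsq j).div_const hL0.le).const_mul (seqA_pos hL0 hm j).le).add
      ((meanLE_inner_noise (xs := xs) hδ hnoise hG hξ hLf.le hsmooth (hreg j).1.1 (hxtQ j)
        (hprev j)).const_mul (seqα_pos hL0 hm j).le))).add
    (((hsq N).div_const (t := 2 * L) (by positivity)).const_mul (seqA_pos hL0 hm N).le)
  refine (hmean.mul_integral_sub_le (hexp N).1 hdet).trans ?_
  have hB := maxExpDist_nonneg (P := P) (xs := xs) (xt := xt) (z := z) (x := x) N
  set B := maxExpDist P xs xt z x N
  -- Only j < N occurs, the last correlation having been absorbed pathwise. The constant obtained is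
  -- 1, within the allowed 3.
  have hcross : ∑ j ∈ Finset.range N,
      seqα L m j * (δ * ∫ ω, ‖prevZ x₀ (fun k => z k ω) j - xs‖ ∂P) ≤ seqA L m N * (B * δ) := by
    calc _ ≤ ∑ j ∈ Finset.range N, seqα L m j * (B * δ) := by
          refine Finset.sum_le_sum fun j hj => ?_
          refine mul_le_mul_of_nonneg_left ?_ (seqα_pos hL0 hm j).le
          rw [mul_comm B]
          exact mul_le_mul_of_nonneg_left (integral_prevZ_le_maxExpDist
            (fun ω => (hrun ω).xt_zero) (Finset.mem_range.1 hj).le) hδ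
      _ = (∑ j ∈ Finset.range N, seqα L m j) * (B * δ) := by rw [Finset.sum_mul]
      _ ≤ _ := by
          refine mul_le_mul_of_nonneg_right ?_ (by positivity)
          rw [← sum_seqα, Finset.sum_range_succ]
          linarith [seqα_pos hL0 hm N]
  rw [Finset.sum_add_distrib, ← Finset.sum_mul]
  have : seqA L m N * (δ ^ 2 / (2 * L)) = seqA L m N / 2 * (δ ^ 2 / L) := by
    field_simp
  rw [this]
  linarith

/-- Expected value of the objective when the modulus is half of the convexity parameter. -/
theorem IsStochasticRun.expected_value_le_of_half_modulus
    (hrun : IsStochasticRun Q f G ξ L (μ / 2) x₀ xt z x)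
    (hL : L = 2 * Lf) (hLf : 0 < Lf) (hμ : 0 < μ) (hQ : Convex ℝ Q)
    (hc : IsClosed Q) (hx₀ : x₀ ∈ Q) (hnoise : BoundedNoise P ℱ Q f' G ξ δ)
    (hG : Measurable (Function.uncurry G)) (hξ : ∀ k, Measurable[ℱ (k + 1)] (ξ k))
    (hsmooth : SmoothOn Q f f' Lf) (hconv : StrongConvexGrad Q f f' μ)
    (hxs : xs ∈ Q) (hmin : IsMinOn f Q xs) (N : ℕ) :
    seqA L (μ / 2) N * ((∫ ω, f (x N ω) ∂P) - f xs) ≤ 1 / 2 * ‖x₀ - xs‖ ^ 2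
      + (∑ j ∈ Finset.range (N + 1), seqA L (μ / 2) j) * (δ ^ 2 / L + δ ^ 2 / μ) := by
  have hL0 : 0 < L := by linarith
  have hm : 0 ≤ μ / 2 := by positivity
  have hreg := hrun.sqIntegrable hL0 hm hQ hc hx₀ hnoise hG hξ hLf.le hsmooth
  have hxtQ : ∀ k ω, xt k ω ∈ Q := fun k ω => (hrun ω).xt_mem hL0 hm hQ hx₀ k
  have hexp := hrun.hasExpectations hL0 hm hQ hc hx₀ hnoise hG hξ hLf.le hsmooth hxs hmin
  have hdet := fun ω => (hrun ω).value_le_of_half_modulus hL0 hμ hQ hx₀ hconv (fun k => by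
    have h := hsmooth.le_quadratic hQ (hxtQ k ω) ((hrun ω).x_mem hL0 hm hQ k)
    rwa [show Lf / 2 = L / 4 by rw [hL]; ring] at h) hxs N
  have hsq : ∀ j, MeanLE P (fun ω => ‖G (xt j ω) (ξ j ω) - f' (xt j ω)‖ ^ 2) (δ ^ 2) :=
    fun j => meanLE_sq_noise hnoise (hreg j).1.1 (hxtQ j)
  have hmean := (MeanLE.const (P := P) (1 / 2 * ‖x₀ - xs‖ ^ 2)).add (MeanLE.sum (N := N + 1)
    fun j _ => (((hsq j).div_const hL0.le).add ((hsq j).div_const hμ.le)).const_mul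
      (seqA_pos hL0 hm j).le)
  refine (hmean.mul_integral_sub_le (hexp N).1 hdet).trans ?_
  rw [Finset.sum_mul]

end Expectation

end STM

/-! ### Assembly of the three rates. -/

theorem theorem6p3 {n : ℕ} {Ω Ξ : Type*} [mΩ : MeasurableSpace Ω] [MeasurableSpace Ξ]
    (P : Measure Ω) [IsProbabilityMeasure P] (ℱ : Filtration ℕ mΩ)
    (Q : Set (EuclideanSpace ℝ (Fin n))) (hQclosed : IsClosed Q) (hQconvex : Convex ℝ Q)
    (f : EuclideanSpace ℝ (Fin n) → ℝ)
    (f' : EuclideanSpace ℝ (Fin n) → EuclideanSpace ℝ (Fin n))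
    (Lf L μ δ R : ℝ) (hLf : 0 < Lf) (hL : L = 2 * Lf) (hμ : 0 ≤ μ) (hδ : 0 ≤ δ)
    (hsmooth : STM.SmoothOn Q f f' Lf) (hconv : STM.StrongConvexGrad Q f f' μ)
    (G : EuclideanSpace ℝ (Fin n) → Ξ → EuclideanSpace ℝ (Fin n))
    (hG : Measurable (Function.uncurry G))
    (ξ : ℕ → Ω → Ξ) (hξ : ∀ k, Measurable[ℱ (k + 1)] (ξ k))
    (hnoise : STM.BoundedNoise P ℱ Q f' G ξ δ)
    (x₀ : EuclideanSpace ℝ (Fin n)) (hx₀ : x₀ ∈ Q)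
    (xs : EuclideanSpace ℝ (Fin n)) (hxs : xs ∈ Q) (hmin : IsMinOn f Q xs)
    (hR : ‖x₀ - xs‖ ≤ R) :
    (μ ≠ 0 → ∀ xt z x : ℕ → Ω → EuclideanSpace ℝ (Fin n),
      STM.IsStochasticRun Q f G ξ L μ x₀ xt z x →
        STM.HasExpectations P f xs xt z x ∧
        ∀ N : ℕ, (∫ ω, f (x N ω) ∂P) - f xs ≤
          L * R ^ 2 * Real.exp (-(1 / 2) * Real.sqrt (μ / L) * N)
            + (1 + Real.sqrt (L / μ)) * (δ ^ 2 / L)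
            + 3 * STM.maxExpDist P xs xt z x N * δ) ∧
    (μ ≠ 0 → ∀ xt z x : ℕ → Ω → EuclideanSpace ℝ (Fin n),
      STM.IsStochasticRun Q f G ξ L (μ / 2) x₀ xt z x →
        STM.HasExpectations P f xs xt z x ∧
        ∀ N : ℕ, (∫ ω, f (x N ω) ∂P) - f xs ≤
          L * R ^ 2 * Real.exp (-(1 / 2) * Real.sqrt ((μ / 2) / L) * N)
            + (1 + Real.sqrt (L / (μ / 2))) * (δ ^ 2 / L)
            + (1 + Real.sqrt (L / (μ / 2))) * (δ ^ 2 / μ)) ∧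
    (μ = 0 → ∀ xt z x : ℕ → Ω → EuclideanSpace ℝ (Fin n),
      STM.IsStochasticRun Q f G ξ L 0 x₀ xt z x →
        STM.HasExpectations P f xs xt z x ∧
        ∀ N : ℕ, 1 ≤ N → (∫ ω, f (x N ω) ∂P) - f xs ≤
          4 * L * R ^ 2 / (N : ℝ) ^ 2
            + 3 * STM.maxExpDist P xs xt z x N * δ
            + N * (δ ^ 2 / L)) := by
  have hL0 : 0 < L := by linarith
  have hL1 : L ≠ 0 := hL0.ne'
  have hR0 : 0 ≤ R := (norm_nonneg _).trans hR
  refine ⟨fun hμ0 xt z x hrun => ?_, fun hμ0 xt z x hrun => ?_, fun hμ0 xt z x hrun => ?_⟩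
  · have hμpos : 0 < μ := lt_of_le_of_ne hμ (Ne.symm hμ0)
    refine ⟨hrun.hasExpectations hL0 hμ hQconvex hQclosed hx₀ hnoise hG hξ hLf.le hsmooth hxs hmin,
      fun N => ?_⟩
    have hB := STM.maxExpDist_nonneg (P := P) (xs := xs) (xt := xt) (z := z) (x := x) N
    -- On a one-point Q, strong convexity does not force μ ≤ L, but then f(x_N) = f(x*).
    rcases Q.subsingleton_or_nontrivial with hQs | hQs
    · rw [hrun.integral_eq_of_subsingleton hL0 hμ hQconvex hxs hQs N, sub_self]
      positivity
    have hμL : μ ≤ L := by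
      have := STM.le_of_strongConvexGrad_of_smoothOn hsmooth hconv hQs
      linarith
    have hA := STM.seqA_pos hL0 hμ N
    have h1 := hrun.expected_value_le_of_full_modulus hL hLf hμ hδ hQconvex hQclosed hx₀ hnoise
      hG hξ hsmooth hconv hxs hmin N
    have h2 := STM.half_sq_div_seqA_le hL0 hμ hμL (norm_nonneg _) hR N
    have h3 := STM.sum_seqA_le hL0 hμpos hμL N
    rw [Finset.sum_range_succ] at h3
    have h4 : (∑ j ∈ Finset.range N, STM.seqA L μ j + STM.seqA L μ N / 2) * (δ ^ 2 / L)
        ≤ (1 + Real.sqrt (L / μ)) * STM.seqA L μ N * (δ ^ 2 / L) :=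
      mul_le_mul_of_nonneg_right (by linarith) (by positivity)
    have h5 : 0 ≤ STM.seqA L μ N * (STM.maxExpDist P xs xt z x N * δ) := by positivity
    refine le_of_mul_le_mul_left ?_ hA
    linarith
  · have hμpos : 0 < μ := lt_of_le_of_ne hμ (Ne.symm hμ0)
    have hm : 0 < μ / 2 := by positivity
    refine ⟨hrun.hasExpectations hL0 hm.le hQconvex hQclosed hx₀ hnoise hG hξ hLf.le hsmooth
      hxs hmin, fun N => ?_⟩
    rcases Q.subsingleton_or_nontrivial with hQs | hQs
    · rw [hrun.integral_eq_of_subsingleton hL0 hm.le hQconvex hxs hQs N, sub_self]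
      positivity
    have hmL : μ / 2 ≤ L := by
      have := STM.le_of_strongConvexGrad_of_smoothOn hsmooth hconv hQs
      linarith
    have h1 := hrun.expected_value_le_of_half_modulus hL hLf hμpos hQconvex hQclosed hx₀ hnoise
      hG hξ hsmooth hconv hxs hmin N
    have h2 := STM.half_sq_div_seqA_le hL0 hm.le hmL (norm_nonneg _) hR N
    have h3 := mul_le_mul_of_nonneg_right (STM.sum_seqA_le hL0 hm hmL N)
      (show 0 ≤ δ ^ 2 / L + δ ^ 2 / μ by positivity)
    refine le_of_mul_le_mul_left ?_ (STM.seqA_pos hL0 hm.le N)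
    linarith
  · subst hμ0
    refine ⟨hrun.hasExpectations hL0 le_rfl hQconvex hQclosed hx₀ hnoise hG hξ hLf.le hsmooth
      hxs hmin, fun N hN => ?_⟩
    have hB := STM.maxExpDist_nonneg (P := P) (xs := xs) (xt := xt) (z := z) (x := x) N
    have hA := STM.seqA_pos hL0 le_rfl N
    have hN0 : (0 : ℝ) < N := by exact_mod_cast hN
    have h1 := hrun.expected_value_le_of_full_modulus hL hLf le_rfl hδ hQconvex hQclosed hx₀
      hnoise hG hξ hsmooth hconv hxs hmin N
    have h2 : 1 / 2 * ‖x₀ - xs‖ ^ 2 ≤ STM.seqA L 0 N * (4 * L * R ^ 2 / (N : ℝ) ^ 2) := by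
      have k1 : (N : ℝ) ^ 2 / (4 * L) ≤ STM.seqA L 0 N := by
        refine le_trans ?_ (STM.sq_le_seqA_zero hL0 N)
        gcongr
        linarith
      have k2 := mul_le_mul_of_nonneg_right k1
        (show 0 ≤ 4 * L * R ^ 2 / (N : ℝ) ^ 2 by positivity)
      have k3 : (N : ℝ) ^ 2 / (4 * L) * (4 * L * R ^ 2 / (N : ℝ) ^ 2) = R ^ 2 := by
        field_simp
      have k4 : ‖x₀ - xs‖ ^ 2 ≤ R ^ 2 := by gcongr
      have k5 : 0 ≤ R ^ 2 := by positivity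
      linarith
    -- The halved last weight yields Nδ²/L already from N = 1.
    have h3 := mul_le_mul_of_nonneg_right (STM.sum_seqA_zero_le hL0 hN)
      (show 0 ≤ δ ^ 2 / L by positivity)
    have h5 : 0 ≤ STM.seqA L 0 N * (STM.maxExpDist P xs xt z x N * δ) := by positivity
    refine le_of_mul_le_mul_left ?_ hA
    linarith
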